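/- Let $n,k\ge 1$ be integers, let $0\le s<r$ and $p\ge 2$ be real numbers, and write $\Delta_0=-\sum_{i=1}^n\partial_{ii}^2$ on $\mathbb{R}^n$ and $x^i\partial_i=\sum_{i=1}^n x^i\partial_i$. Let $u\in C^{2k}(\overline{B(0,r)})$ and $f\in C^1(\overline{B(0,r)})$ be real-valued, and put $\mathcal{E}(u)=\Delta_0^k u-f|u|^{p-2}u$. For $0<\rho\le r$ define, with $\nu(x)=x/|x|$ and with $\sigma$ the surface measure of $\partial B(0,\rho)$, $$\mathcal{P}_k(\rho;u)=\mathcal{R}_k(\rho;u)+\sum_{i=0}^{\lfloor k/2\rfloor-1}\Big[\frac{n-2k}{2}\int_{\partial B(0,\rho)}\big(\partial_\nu(\Delta_0^iu)\,\Delta_0^{k-i-1}u-\Delta_0^iu\,\partial_\nu(\Delta_0^{k-i-1}u)\big)\,d\sigma+\int_{\partial B(0,\rho)}\big(\partial_\nu(\Delta_0^i(x^a\partial_au))\,\Delta_0^{k-i-1}u-\Delta_0^i(x^a\partial_au)\,\partial_\nu(\Delta_0^{k-i-1}u)\big)\,d\sigma\Big],$$ where $$\mathcal{R}_k(\rho;u)=\frac{\rho}{2}\int_{\partial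 B(0,\rho)}(\Delta_0^{k/2}u)^2\,d\sigma\qquad\text{if $k$ is even,}$$ and, if $k$ is odd, with $w=\Delta_0^{(k-1)/2}u$, $$\mathcal{R}_k(\rho;u)=\frac{\rho}{2}\int_{\partial B(0,\rho)}(\Delta_0^{\frac{k+1}{2}}u)\,w\,d\sigma+\frac12\int_{\partial B(0,\rho)}\big(w\,\partial_\nu(x^a\partial_aw)-(x^a\partial_aw)\,\partial_\nu w\big)\,d\sigma .$$ For $\rho=0$ all boundary terms are zero. Then $$\begin{aligned}\mathcal{P}_k(r;u)-\mathcal{P}_k(s;u)={}&\int_{B(0,r)\setminus B(0,s)}\Big(\frac{n-2k}{2}u+x^i\partial_iu\Big)\mathcal{E}(u)\,dx+\Big(\frac{n-2k}{2}-\frac np\Big)\int_{B(0,r)\setminus B(0,s)}f|u|^p\,dx\\&-\frac1p\int_{B(0,r)\setminus B(0,s)}x^i\partial_if\,|u|^p\,dx+\frac rp\int_{\partial B(0,r)}f|u|^p\,d\sigma-\frac sp\int_{\partial B(0,s)}f|u|^p\,d\sigma .\end{aligned}$$ -/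

import Mathlib

open Set Metric MeasureTheory
open scoped InnerProductSpace

namespace PolyPohozaev

/-- The space `ℝⁿ` with its Euclidean norm. -/
abbrev Euc (n : ℕ) : Type := EuclideanSpace ℝ (Fin n)

/-- The `i`-th power `Δ₀^i u` of the non-negative Euclidean Laplacian `Δ₀ = -∑ⱼ ∂ⱼⱼ`, for a function
`u` given on the set `D`. Derivatives are taken within `D`; when `D` is a closed ball of positive
radius and `u` is regular enough up to the boundary, these are the usual derivatives in the interior
of `D` and their continuous extensions to the boundary of `D`. -/
noncomputable def polyLap {n : ℕ} (D : Set (Euc n)) (i : ℕ) (u : Euc n → ℝ) : Euc n → ℝ :=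
  (fun v : Euc n → ℝ => fun x => -(Δ[D] v) x)^[i] u

/-- The derivative `x ↦ xᵃ ∂ₐ u (x) = ⟨x, ∇u(x)⟩`. -/
noncomputable def eulerDeriv {n : ℕ} (D : Set (Euc n)) (u : Euc n → ℝ) : Euc n → ℝ :=
  fun x => fderivWithin ℝ u D x x

/-- The derivative `∂_ν u` in the direction `ν = x / |x|`, the outer unit normal of the sphere
centred at the origin that passes through `x`. -/
noncomputable def normalDeriv {n : ℕ} (D : Set (Euc n)) (u : Euc n → ℝ) : Euc n → ℝ :=
  fun x => fderivWithin ℝ u D x (‖x‖⁻¹ • x)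

/-- The integral `∫_{∂B(0,ρ)} g dσ` for the surface measure `σ`, written over the unit sphere
(`Measure.toSphere` is the surface measure of the unit sphere). -/
noncomputable def sphereIntegral {n : ℕ} (ρ : ℝ) (g : Euc n → ℝ) : ℝ :=
  ρ ^ (n - 1) * ∫ ω : sphere (0 : Euc n) 1, g (ρ • (ω : Euc n)) ∂((volume : Measure (Euc n)).toSphere)

/-- The boundary term `𝓡_k(ρ; u)`. -/
noncomputable def bdryR {n : ℕ} (D : Set (Euc n)) (k : ℕ) (ρ : ℝ) (u : Euc n → ℝ) : ℝ :=
  if Even k then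
    ρ / 2 * sphereIntegral ρ (fun x => (polyLap D (k / 2) u x) ^ 2)
  else
    ρ / 2 * sphereIntegral ρ
        (fun x => polyLap D ((k + 1) / 2) u x * polyLap D ((k - 1) / 2) u x)
      + 1 / 2 * sphereIntegral ρ (fun x =>
          polyLap D ((k - 1) / 2) u x
              * normalDeriv D (eulerDeriv D (polyLap D ((k - 1) / 2) u)) x
            - eulerDeriv D (polyLap D ((k - 1) / 2) u) x
              * normalDeriv D (polyLap D ((k - 1) / 2) u) x)

/-- The boundary functional `𝓟_k(ρ; u)` of a function `u` given on `D`. -/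
noncomputable def bdryP {n : ℕ} (D : Set (Euc n)) (k : ℕ) (ρ : ℝ) (u : Euc n → ℝ) : ℝ :=
  bdryR D k ρ u
    + ∑ i ∈ Finset.range (k / 2),
      (((n : ℝ) - 2 * k) / 2 * sphereIntegral ρ (fun x =>
          normalDeriv D (polyLap D i u) x * polyLap D (k - i - 1) u x
            - polyLap D i u x * normalDeriv D (polyLap D (k - i - 1) u) x)
        + sphereIntegral ρ (fun x =>
          normalDeriv D (polyLap D i (eulerDeriv D u)) x * polyLap D (k - i - 1) u x
            - polyLap D i (eulerDeriv D u) x * normalDeriv D (polyLap D (k - i - 1) u) x))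

/-- The expression `𝓔(u) = Δ₀^k u - f |u|^(p-2) u`. -/
noncomputable def equationError {n : ℕ} (D : Set (Euc n)) (k : ℕ) (p : ℝ) (f u : Euc n → ℝ) :
    Euc n → ℝ :=
  fun x => polyLap D k u x - f x * |u x| ^ (p - 2) * u x

end PolyPohozaev

namespace PolyPohozaev

/-! Write `E` for the Euler derivative and put `X = (n - 2k)/2 u + E u`. Pairing `X` with `Δ₀^k u`
over the annulus, one moves `⌊k/2⌋` Laplacians from `u` onto `X` by Green's formula; the boundary
terms are exactly the sum in `bdryP` (`setIntegral_annulus_mul_polyLap`). Since `E` is homogeneous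
of degree zero, `Δ₀^m (E u) = E (Δ₀^m u) + 2m Δ₀^m u` (`polyLap_eulerDeriv`), so with `w = Δ₀^m u`
and `m = ⌊k/2⌋` the remaining integrand is `(n/2 w + E w) w` for even `k` and `((n - 2)/2 w + E w)
Δ₀ w` for odd `k`. Both are divergences: the first of `x w²/2`, the second of the classical Pohozaev
field of `w`.

The flux of the Pohozaev field contains `|∇w|²`, which `bdryR` does not. On each sphere it is
removed by integrating the tangential divergence of `w ∇w` to zero (`sphInt_pohozaevField`). The
nonlinearity enters through `E (f |u|^p)` and the divergence of `x f |u|^p`.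

The divergence theorem on the annulus is itself derived here. Rotation invariance of the sphere
measure kills integrals of angular derivatives (`integral_toSphere_angularDeriv`); this converts the
spherical mean of `∂ᵢ h` into a radial derivative, and polar coordinates with the fundamental
theorem of calculus finish (`setIntegral_annulus_pd`). -/

/-- The `i`-th partial derivative of `v` within `D`. -/
noncomputable def pd {n : ℕ} (D : Set (Euc n)) (i : Fin n) (v : Euc n → ℝ) : Euc n → ℝ :=
  fun x => fderivWithin ℝ v D x (EuclideanSpace.single i 1)

/-! ### Calculus of partial derivatives within a set, and the commutator of the Laplacian with the
Euler derivative. -/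

section PartialDerivatives

variable {n : ℕ} {D : Set (Euc n)} {x : Euc n} {u v w : Euc n → ℝ}

theorem fderivWithin_eq_sum_pd (D : Set (Euc n)) (v : Euc n → ℝ) (x y : Euc n) :
    fderivWithin ℝ v D x y = ∑ i, y i * pd D i v x := by
  have hy : y = ∑ i, y i • EuclideanSpace.single i (1 : ℝ) := by
    have := (EuclideanSpace.basisFun (Fin n) ℝ).sum_repr y
    simpa using this.symm
  conv_lhs => rw [hy]
  simp [pd, map_sum]

theorem eulerDeriv_eq_sum (D : Set (Euc n)) (v : Euc n → ℝ) :
    eulerDeriv D v = fun x => ∑ i, x i * pd D i v x :=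
  funext fun x => fderivWithin_eq_sum_pd D v x x

theorem pd_contDiffOn (hD : UniqueDiffOn ℝ D) {m : ℕ} (hv : ContDiffOn ℝ (m + 1 : ℕ) v D)
    (i : Fin n) : ContDiffOn ℝ m (pd D i v) D :=
  (hv.fderivWithin hD (by push_cast; exact le_rfl)).clm_apply contDiffOn_const

theorem pd_congr (h : EqOn v w D) (hx : x ∈ D) (i : Fin n) : pd D i v x = pd D i w x := by
  simp only [pd]
  rw [fderivWithin_congr h (h hx)]

theorem pd_add (hD : UniqueDiffOn ℝ D) (hx : x ∈ D) (hv : DifferentiableWithinAt ℝ v D x)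
    (hw : DifferentiableWithinAt ℝ w D x) (i : Fin n) :
    pd D i (fun y => v y + w y) x = pd D i v x + pd D i w x := by
  simp only [pd]
  rw [fderivWithin_fun_add (hD x hx) hv hw]
  rfl

theorem pd_sub (hD : UniqueDiffOn ℝ D) (hx : x ∈ D) (hv : DifferentiableWithinAt ℝ v D x)
    (hw : DifferentiableWithinAt ℝ w D x) (i : Fin n) :
    pd D i (fun y => v y - w y) x = pd D i v x - pd D i w x := by
  simp only [pd]
  rw [fderivWithin_fun_sub (hD x hx) hv hw]
  rfl

theorem pd_mul (hD : UniqueDiffOn ℝ D) (hx : x ∈ D) (hv : DifferentiableWithinAt ℝ v D x)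
    (hw : DifferentiableWithinAt ℝ w D x) (i : Fin n) :
    pd D i (fun y => v y * w y) x = v x * pd D i w x + w x * pd D i v x := by
  simp only [pd]
  rw [fderivWithin_fun_mul (hD x hx) hv hw]
  rfl

theorem pd_const_mul (hD : UniqueDiffOn ℝ D) (hx : x ∈ D) (c : ℝ)
    (hv : DifferentiableWithinAt ℝ v D x) (i : Fin n) :
    pd D i (fun y => c * v y) x = c * pd D i v x := by
  simp only [pd]
  rw [fderivWithin_const_mul (hD x hx) hv]
  rfl

theorem pd_sum {ι : Type*} (s : Finset ι) {a : ι → Euc n → ℝ} (hD : UniqueDiffOn ℝ D) (hx : x ∈ D)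
    (ha : ∀ j ∈ s, DifferentiableWithinAt ℝ (a j) D x) (i : Fin n) :
    pd D i (fun y => ∑ j ∈ s, a j y) x = ∑ j ∈ s, pd D i (a j) x := by
  simp only [pd]
  rw [fderivWithin_fun_sum (hD x hx) ha]
  simp

theorem differentiableWithinAt_coord (j : Fin n) :
    DifferentiableWithinAt ℝ (fun y : Euc n => y j) D x :=
  ((EuclideanSpace.proj j : Euc n →L[ℝ] ℝ).differentiableAt).differentiableWithinAt

theorem contDiff_coord {m : WithTop ℕ∞} (j : Fin n) : ContDiff ℝ m (fun y : Euc n => y j) :=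
  (EuclideanSpace.proj j : Euc n →L[ℝ] ℝ).contDiff

theorem pd_coord (hD : UniqueDiffOn ℝ D) (hx : x ∈ D) (i j : Fin n) :
    pd D i (fun y => y j) x = if j = i then 1 else 0 := by
  simp only [pd]
  have := (EuclideanSpace.proj j : Euc n →L[ℝ] ℝ).fderivWithin (hD x hx)
  have h2 : (fun y : Euc n => y j) = (EuclideanSpace.proj j : Euc n →L[ℝ] ℝ) := rfl
  rw [h2, this]
  simp

theorem pd_coord_mul (hD : UniqueDiffOn ℝ D) (hx : x ∈ D) (hv : DifferentiableWithinAt ℝ v D x)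
    (i j : Fin n) :
    pd D i (fun y => y j * v y) x = x j * pd D i v x + if j = i then v x else 0 := by
  rw [pd_mul hD hx (differentiableWithinAt_coord j) hv, pd_coord hD hx]
  simp

theorem pd_sum_coord_mul (hD : UniqueDiffOn ℝ D) (hx : x ∈ D) {a : Fin n → Euc n → ℝ}
    (ha : ∀ j, DifferentiableWithinAt ℝ (a j) D x) (i : Fin n) :
    pd D i (fun y => ∑ j, y j * a j y) x = a i x + ∑ j, x j * pd D i (a j) x := by
  rw [pd_sum _ hD hx fun j _ => (differentiableWithinAt_coord j).fun_mul (ha j)]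
  simp only [pd_coord_mul hD hx (ha _), Finset.sum_add_distrib]
  simp [add_comm]

theorem pd_pd_eq (hD : UniqueDiffOn ℝ D) (hv : ContDiffOn ℝ 2 v D) (hx : x ∈ D) (i j : Fin n) :
    pd D i (pd D j v) x = fderivWithin ℝ (fderivWithin ℝ v D) D x (EuclideanSpace.single i 1)
      (EuclideanSpace.single j 1) := by
  have h1 : DifferentiableWithinAt ℝ (fderivWithin ℝ v D) D x :=
    ((hv.fderivWithin (m := 1) hD (by norm_num)).differentiableOn one_ne_zero) x hx
  unfold pd
  rw [fderivWithin_clm_apply (hD x hx) h1 (differentiableWithinAt_const _)]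
  simp

/-- Density of the interior in `D` carries the symmetry of second derivatives to the boundary
points. -/
theorem pd_comm (hD : UniqueDiffOn ℝ D) (hc : D ⊆ closure (interior D))
    (hv : ContDiffOn ℝ 2 v D) (hx : x ∈ D) (i j : Fin n) :
    pd D i (pd D j v) x = pd D j (pd D i v) x := by
  rw [pd_pd_eq hD hv hx, pd_pd_eq hD hv hx]
  exact (hv x hx).isSymmSndFDerivWithinAt (by simp) hD (hc hx) hx _ _

theorem laplacianWithin_eq_sum (hD : UniqueDiffOn ℝ D) (hv : ContDiffOn ℝ 2 v D) (hx : x ∈ D) :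
    (Δ[D] v) x = ∑ i, pd D i (pd D i v) x := by
  rw [InnerProductSpace.laplacianWithin_eq_iteratedFDerivWithin_orthonormalBasis v hD hx
    (EuclideanSpace.basisFun (Fin n) ℝ)]
  refine Finset.sum_congr rfl fun i _ => ?_
  rw [iteratedFDerivWithin_two_apply v hD hx, pd_pd_eq hD hv hx]
  simp

theorem differentiableWithinAt_of_contDiffOn {m : ℕ} (hv : ContDiffOn ℝ (m + 1 : ℕ) v D)
    (hx : x ∈ D) :
    DifferentiableWithinAt ℝ v D x :=
  hv.differentiableOn (by simp) x hx

theorem eulerDeriv_contDiffOn (hD : UniqueDiffOn ℝ D) {m : ℕ} (hv : ContDiffOn ℝ (m + 1 : ℕ) v D) :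
    ContDiffOn ℝ m (eulerDeriv D v) D := by
  rw [eulerDeriv_eq_sum]
  exact ContDiffOn.sum fun i _ => (contDiff_coord i).contDiffOn.mul (pd_contDiffOn hD hv i)

theorem pd_eulerDeriv (hD : UniqueDiffOn ℝ D) (hv : ContDiffOn ℝ 2 v D) (hx : x ∈ D) (j : Fin n) :
    pd D j (eulerDeriv D v) x = pd D j v x + ∑ i, x i * pd D j (pd D i v) x := by
  rw [eulerDeriv_eq_sum, pd_sum_coord_mul hD hx]
  exact fun i => differentiableWithinAt_of_contDiffOn (m := 0)
    (pd_contDiffOn hD (m := 1) (by exact_mod_cast hv) i) hx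

/-- Each `∂ⱼ` that passes the coefficient `xⁱ` of the Euler derivative leaves one extra `∂ⱼ`, so
`∂ⱼ∂ⱼ` leaves `2 ∂ⱼ∂ⱼ`. The third derivatives that appear are reordered with `pd_comm`. -/
theorem laplacianWithin_eulerDeriv (hD : UniqueDiffOn ℝ D) (hc : D ⊆ closure (interior D))
    (hv : ContDiffOn ℝ 3 v D) (hx : x ∈ D) :
    (Δ[D] (eulerDeriv D v)) x = eulerDeriv D (Δ[D] v) x + 2 * (Δ[D] v) x := by
  have hv3 : ContDiffOn ℝ (2 + 1 : ℕ) v D := by exact_mod_cast hv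
  have hv2 : ContDiffOn ℝ 2 v D := hv.of_le (by norm_num)
  have hp : ∀ i, ContDiffOn ℝ (1 + 1 : ℕ) (pd D i v) D := fun i => pd_contDiffOn hD hv3 i
  have hp2 : ∀ i, ContDiffOn ℝ 2 (pd D i v) D := fun i => by exact_mod_cast hp i
  have hpp : ∀ i j, ContDiffOn ℝ (0 + 1 : ℕ) (pd D j (pd D i v)) D :=
    fun i j => pd_contDiffOn hD (hp i) j
  have hE : ContDiffOn ℝ 2 (eulerDeriv D v) D := by exact_mod_cast eulerDeriv_contDiffOn hD hv3
  have key : ∀ j, pd D j (pd D j (eulerDeriv D v)) x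
      = 2 * pd D j (pd D j v) x + ∑ i, x i * pd D i (pd D j (pd D j v)) x := by
    intro j
    rw [pd_congr (fun y hy => pd_eulerDeriv hD hv2 hy j) hx j,
      pd_add hD hx (differentiableWithinAt_of_contDiffOn (hp j) hx)
        (DifferentiableWithinAt.fun_sum fun i _ =>
          (differentiableWithinAt_coord i).fun_mul (differentiableWithinAt_of_contDiffOn (hpp i j) hx)),
      pd_sum_coord_mul hD hx fun i => differentiableWithinAt_of_contDiffOn (hpp i j) hx]
    have : ∀ i, pd D j (pd D j (pd D i v)) x = pd D i (pd D j (pd D j v)) x := fun i => by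
      rw [pd_congr (fun y hy => pd_comm hD hc hv2 hy j i) hx j, pd_comm hD hc (hp2 j) hx]
    simp only [this]
    ring
  rw [laplacianWithin_eq_sum hD hE hx, eulerDeriv_eq_sum D (Δ[D] v),
    laplacianWithin_eq_sum hD hv2 hx]
  simp only [key, Finset.sum_add_distrib, ← Finset.mul_sum]
  rw [Finset.sum_comm, add_comm]
  congr 1
  refine Finset.sum_congr rfl fun i _ => ?_
  rw [pd_congr (fun y hy => laplacianWithin_eq_sum hD hv2 hy) hx i,
    pd_sum _ hD hx fun j _ => differentiableWithinAt_of_contDiffOn (hpp j j) hx, Finset.mul_sum]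

theorem laplacianWithin_contDiffOn (hD : UniqueDiffOn ℝ D) {m : ℕ}
    (hv : ContDiffOn ℝ (m + 2 : ℕ) v D) : ContDiffOn ℝ m (Δ[D] v) D := by
  have hv2 : ContDiffOn ℝ 2 v D := hv.of_le (by exact_mod_cast Nat.le_add_left 2 m)
  refine ContDiffOn.congr (ContDiffOn.sum fun i (_ : i ∈ Finset.univ) =>
    pd_contDiffOn hD (pd_contDiffOn hD (m := m + 1) hv i) i)
    fun y hy => laplacianWithin_eq_sum hD hv2 hy

theorem laplacianWithin_congr (hD : UniqueDiffOn ℝ D) (h : EqOn v w D) (hx : x ∈ D) :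
    (Δ[D] v) x = (Δ[D] w) x := by
  simp only [InnerProductSpace.laplacianWithin_eq_iteratedFDerivWithin_stdOrthonormalBasis _ hD hx,
    iteratedFDerivWithin_congr h hx]

theorem polyLap_succ (D : Set (Euc n)) (i : ℕ) (u : Euc n → ℝ) :
    polyLap D (i + 1) u = fun x => -(Δ[D] (polyLap D i u)) x :=
  Function.iterate_succ_apply' _ i u

theorem polyLap_zero (D : Set (Euc n)) (u : Euc n → ℝ) : polyLap D 0 u = u := rfl

theorem polyLap_contDiffOn (hD : UniqueDiffOn ℝ D) (i : ℕ) {m : ℕ}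
    (hu : ContDiffOn ℝ (m + 2 * i : ℕ) u D) : ContDiffOn ℝ m (polyLap D i u) D := by
  induction i generalizing m with
  | zero => simpa [polyLap_zero] using hu
  | succ i ih =>
    rw [polyLap_succ]
    refine (laplacianWithin_contDiffOn hD (ih (m := m + 2) ?_)).neg
    convert hu using 2
    ring

theorem pd_neg (hD : UniqueDiffOn ℝ D) (hx : x ∈ D) (v : Euc n → ℝ) (i : Fin n) :
    pd D i (fun y => -v y) x = -pd D i v x := by
  simp only [pd]
  rw [fderivWithin_fun_neg (hD x hx)]
  rfl

/-- Every further Laplacian adds one commutator, hence the factor `2 * i`. -/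
theorem polyLap_eulerDeriv (hD : UniqueDiffOn ℝ D) (hc : D ⊆ closure (interior D)) (i : ℕ)
    (hu : ContDiffOn ℝ (2 * i + 1 : ℕ) u D) (hx : x ∈ D) :
    polyLap D i (eulerDeriv D u) x
      = eulerDeriv D (polyLap D i u) x + 2 * i * polyLap D i u x := by
  induction i generalizing x with
  | zero => simp [polyLap_zero]
  | succ i ih =>
    have hw : ContDiffOn ℝ (2 + 1 : ℕ) (polyLap D i u) D :=
      polyLap_contDiffOn hD i (by convert hu using 2; ring)
    have hw3 : ContDiffOn ℝ 3 (polyLap D i u) D := by exact_mod_cast hw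
    have hw2 : ContDiffOn ℝ 2 (polyLap D i u) D := hw3.of_le (by norm_num)
    have hs : ContDiffWithinAt ℝ 2 ((2 * i : ℝ) • polyLap D i u) D x :=
      (hw2 x hx).const_smul (2 * i : ℝ)
    have hE : ContDiffOn ℝ 2 (eulerDeriv D (polyLap D i u)) D := by
      exact_mod_cast eulerDeriv_contDiffOn hD hw
    have h1 : EqOn (polyLap D i (eulerDeriv D u))
        (eulerDeriv D (polyLap D i u) + (2 * i : ℝ) • polyLap D i u) D := fun y hy => by
      rw [ih (hu.of_le (by norm_cast; lia)) hy]
      rfl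
    simp only [polyLap_succ]
    rw [laplacianWithin_congr hD h1 hx, ContDiffWithinAt.laplacianWithin_add (hE x hx) hs hD hx,
      InnerProductSpace.laplacianWithin_smul _ (hw2 x hx) hD hx,
      laplacianWithin_eulerDeriv hD hc hw3 hx]
    simp only [eulerDeriv_eq_sum, pd_neg hD hx, smul_eq_mul]
    push_cast
    simp only [mul_neg, Finset.sum_neg_distrib]
    ring

end PartialDerivatives

/-! ### Rotation invariance of the surface measure and vanishing integrals of angular derivatives.
-/

section Sphere

open scoped Pointwise

variable {n : ℕ}

/-- The map of the unit sphere to itself induced by a linear isometry. -/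
noncomputable def sphereMap (e : Euc n ≃ₗᵢ[ℝ] Euc n) (ω : sphere (0 : Euc n) 1) :
    sphere (0 : Euc n) 1 :=
  ⟨e ω, by simp⟩

theorem sphereMap_continuous (e : Euc n ≃ₗᵢ[ℝ] Euc n) : Continuous (sphereMap e) :=
  (e.continuous.comp continuous_subtype_val).subtype_mk _

/-- The spherical measure of `A` is a multiple of the volume of the cone `(0,1) • A`, and a linear
isometry carries cones to cones without changing volume. -/
theorem measurePreserving_sphereMap (e : Euc n ≃ₗᵢ[ℝ] Euc n) :
    MeasurePreserving (sphereMap e) (volume : Measure (Euc n)).toSphere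
      (volume : Measure (Euc n)).toSphere := by
  refine ⟨(sphereMap_continuous e).measurable, Measure.ext fun A hA => ?_⟩
  have hm := (sphereMap_continuous e).measurable
  rw [Measure.map_apply hm hA, Measure.toSphere_apply' _ (hm hA), Measure.toSphere_apply' _ hA]
  congr 1
  have h : Ioo (0 : ℝ) 1 • (Subtype.val '' (sphereMap e ⁻¹' A) : Set (Euc n))
      = e ⁻¹' (Ioo (0 : ℝ) 1 • (Subtype.val '' A)) := by
    ext x
    simp only [Set.mem_smul, mem_image, mem_preimage]
    constructor
    · rintro ⟨t, ht, _, ⟨ω, hω, rfl⟩, rfl⟩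
      exact ⟨t, ht, _, ⟨_, hω, rfl⟩, by simp [sphereMap]⟩
    · rintro ⟨t, ht, _, ⟨ω, hω, rfl⟩, hx⟩
      refine ⟨t, ht, _, ⟨sphereMap e.symm ω, ?_, rfl⟩, ?_⟩
      · convert hω
        ext1
        simp [sphereMap]
      · simp only [sphereMap]
        rw [← e.symm.map_smul, hx, e.symm_apply_apply]
  rw [h]
  exact (e.measurePreserving).measure_preimage_emb e.toMeasurableEquiv.measurableEmbedding _

theorem integral_toSphere_comp (e : Euc n ≃ₗᵢ[ℝ] Euc n) (g : Euc n → ℝ) :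
    ∫ ω : sphere (0 : Euc n) 1, g (e ω) ∂(volume : Measure (Euc n)).toSphere
      = ∫ ω : sphere (0 : Euc n) 1, g ω ∂(volume : Measure (Euc n)).toSphere := by
  have hemb : MeasurableEmbedding (sphereMap e) := by
    refine (Topology.IsClosedEmbedding.measurableEmbedding ?_)
    refine (sphereMap_continuous e).isClosedEmbedding fun a b hab => ?_
    have := congrArg Subtype.val hab
    exact Subtype.ext (e.injective this)
  exact (measurePreserving_sphereMap e).integral_comp hemb (fun ω => g ω)

theorem integral_toSphere_of_odd {g : Euc n → ℝ} (hg : ∀ x, g (-x) = -g x) :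
    ∫ ω : sphere (0 : Euc n) 1, g ω ∂(volume : Measure (Euc n)).toSphere = 0 := by
  have := integral_toSphere_comp (LinearIsometryEquiv.neg ℝ) g
  simp only [LinearIsometryEquiv.coe_neg, hg, integral_neg] at this
  linarith

/-- Rotation by `θ` in the plane of the `i`-th and `j`-th coordinates. -/
noncomputable def rotate (i j : Fin n) (θ : ℝ) (x : Euc n) : Euc n :=
  x + (((Real.cos θ - 1) * x i - Real.sin θ * x j) • EuclideanSpace.single i (1 : ℝ)
    + (Real.sin θ * x i + (Real.cos θ - 1) * x j) • EuclideanSpace.single j (1 : ℝ))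

theorem norm_rotate {i j : Fin n} (hij : i ≠ j) (θ : ℝ) (x : Euc n) : ‖rotate i j θ x‖ = ‖x‖ := by
  have h : ‖rotate i j θ x‖ ^ 2 = ‖x‖ ^ 2 := by
    unfold rotate
    set a := (Real.cos θ - 1) * x i - Real.sin θ * x j with ha
    set b := Real.sin θ * x i + (Real.cos θ - 1) * x j with hb
    rw [norm_add_sq_real, norm_add_sq_real, inner_add_right]
    simp only [inner_smul_right, inner_smul_left, norm_smul, PiLp.norm_single,
      EuclideanSpace.inner_single_right, PiLp.single_apply, norm_one, mul_one,
      Real.norm_eq_abs, sq_abs]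
    simp only [hij.symm, ha, hb]
    simp
    linear_combination (x i ^ 2 + x j ^ 2) * Real.sin_sq_add_cos_sq θ
  exact (sq_eq_sq₀ (norm_nonneg _) (norm_nonneg _)).1 h

/-- `rotate` as a linear isometry. -/
noncomputable def rotateₗᵢ {i j : Fin n} (hij : i ≠ j) (θ : ℝ) : Euc n ≃ₗᵢ[ℝ] Euc n :=
  LinearIsometry.toLinearIsometryEquiv
    { toFun := rotate i j θ
      map_add' := fun x y => by
        ext k
        simp [rotate]
        split_ifs <;> ring
      map_smul' := fun c x => by
        ext k
        simp [rotate]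
        split_ifs <;> ring
      norm_map' := norm_rotate hij θ } rfl

theorem rotateₗᵢ_apply {i j : Fin n} (hij : i ≠ j) (θ : ℝ) (x : Euc n) :
    rotateₗᵢ hij θ x = rotate i j θ x := rfl

theorem rotate_smul (i j : Fin n) (θ ρ : ℝ) (x : Euc n) :
    rotate i j θ (ρ • x) = ρ • rotate i j θ x := by
  ext k
  simp [rotate]
  split_ifs <;> ring

theorem rotate_zero (i j : Fin n) (x : Euc n) : rotate i j 0 x = x := by
  simp [rotate]

/-- The derivative of `rotate i j θ x` with respect to `θ`. -/
noncomputable def rotateDeriv (i j : Fin n) (θ : ℝ) (x : Euc n) : Euc n :=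
  (-Real.sin θ * x i - Real.cos θ * x j) • EuclideanSpace.single i (1 : ℝ)
    + (Real.cos θ * x i + -Real.sin θ * x j) • EuclideanSpace.single j (1 : ℝ)

theorem hasDerivAt_rotate (i j : Fin n) (θ : ℝ) (x : Euc n) :
    HasDerivAt (fun θ => rotate i j θ x) (rotateDeriv i j θ x) θ := by
  have hs := Real.hasDerivAt_sin θ
  have hc := (Real.hasDerivAt_cos θ).sub_const 1
  exact ((((hc.mul_const (x i)).sub (hs.mul_const (x j))).smul_const _).add
    (((hs.mul_const (x i)).add (hc.mul_const (x j))).smul_const _)).const_add x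

theorem continuous_rotate_smul (i j : Fin n) (ρ : ℝ) :
    Continuous fun p : ℝ × sphere (0 : Euc n) 1 => rotate i j p.1 (ρ • (p.2 : Euc n)) := by
  unfold rotate
  fun_prop

theorem continuous_rotateDeriv_smul (i j : Fin n) (ρ : ℝ) :
    Continuous fun p : ℝ × sphere (0 : Euc n) 1 => rotateDeriv i j p.1 (ρ • (p.2 : Euc n)) := by
  unfold rotateDeriv
  fun_prop

/-- The curve may run along the boundary of `D`; as it stays in `D` on both sides of `t`, the
derivative within `D` still gives a two-sided chain rule. -/
theorem hasDerivAt_comp_of_eventually_mem {D : Set (Euc n)} {g : Euc n → ℝ} {c : ℝ → Euc n}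
    {c' : Euc n} {t : ℝ} (hg : DifferentiableWithinAt ℝ g D (c t)) (hc : HasDerivAt c c' t)
    (hm : ∀ᶠ τ in nhds t, c τ ∈ D) :
    HasDerivAt (fun τ => g (c τ)) (fderivWithin ℝ g D (c t) c') t := by
  have h := hg.hasFDerivWithinAt.comp_hasDerivWithinAt (s := c ⁻¹' D) t hc.hasDerivWithinAt
    (mapsTo_preimage _ _)
  exact h.hasDerivAt hm

theorem smul_mem_closedBall {r ρ : ℝ} (hρ0 : 0 ≤ ρ) (hρ : ρ ≤ r) (ω : sphere (0 : Euc n) 1) :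
    ρ • (ω : Euc n) ∈ closedBall (0 : Euc n) r := by
  simpa [norm_smul, abs_of_nonneg hρ0] using hρ

theorem continuous_comp_smul {r ρ : ℝ} (hρ0 : 0 ≤ ρ) (hρ : ρ ≤ r) {g : Euc n → ℝ}
    (hg : ContinuousOn g (closedBall 0 r)) :
    Continuous fun ω : sphere (0 : Euc n) 1 => g (ρ • (ω : Euc n)) :=
  hg.comp_continuous (by fun_prop) (smul_mem_closedBall hρ0 hρ)

theorem integrable_toSphere {g : sphere (0 : Euc n) 1 → ℝ} (hg : Continuous g) :
    Integrable g (volume : Measure (Euc n)).toSphere :=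
  hg.integrable_of_hasCompactSupport (HasCompactSupport.of_compactSpace g)

theorem uniqueDiffOn_closedBall {r : ℝ} (hr : 0 < r) :
    UniqueDiffOn ℝ (closedBall (0 : Euc n) r) := by
  refine uniqueDiffOn_convex (convex_closedBall _ _) ?_
  exact ⟨0, ball_subset_interior_closedBall (mem_ball_self hr)⟩

theorem closedBall_subset_closure_interior {r : ℝ} (hr : 0 < r) :
    closedBall (0 : Euc n) r ⊆ closure (interior (closedBall 0 r)) := by
  rw [interior_closedBall _ hr.ne', closure_ball _ hr.ne']

/-- The integrand is the derivative at `θ = 0` of `g` along the rotation in the `(i, j)` plane,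
whose spherical integral does not depend on `θ`. -/
theorem integral_toSphere_angularDeriv {r ρ : ℝ} (hr : 0 < r) (hρ0 : 0 ≤ ρ) (hρ : ρ ≤ r)
    {g : Euc n → ℝ} (hg : ContDiffOn ℝ 1 g (closedBall 0 r)) (i j : Fin n) :
    ∫ ω : sphere (0 : Euc n) 1, (ρ * (ω : Euc n) i * pd (closedBall 0 r) j g (ρ • (ω : Euc n))
      - ρ * (ω : Euc n) j * pd (closedBall 0 r) i g (ρ • (ω : Euc n)))
      ∂(volume : Measure (Euc n)).toSphere = 0 := by
  by_cases hij : i = j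
  · subst hij
    simp
  set D := closedBall (0 : Euc n) r
  have hD : UniqueDiffOn ℝ D := uniqueDiffOn_closedBall hr
  have hmem : ∀ θ (ω : sphere (0 : Euc n) 1), rotate i j θ (ρ • (ω : Euc n)) ∈ D := fun θ ω => by
    simpa [D, norm_rotate hij, norm_smul, abs_of_nonneg hρ0] using hρ
  have hcont := hg.continuousOn
  have hcont' : ContinuousOn (fderivWithin ℝ g D) D := hg.continuousOn_fderivWithin hD le_rfl
  have hrc := continuous_rotate_smul i j ρ
  have hrc' := continuous_rotateDeriv_smul i j ρ
  have hF : Continuous fun p : ℝ × sphere (0 : Euc n) 1 =>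
      g (rotate i j p.1 (ρ • (p.2 : Euc n))) :=
    hcont.comp_continuous hrc fun p => hmem _ _
  have hF' : Continuous fun p : ℝ × sphere (0 : Euc n) 1 =>
      fderivWithin ℝ g D (rotate i j p.1 (ρ • (p.2 : Euc n)))
        (rotateDeriv i j p.1 (ρ • (p.2 : Euc n))) :=
    (hcont'.comp_continuous hrc fun p => hmem _ _).clm_apply hrc'
  -- Compactness of `[-1, 1]` times the sphere supplies the constant dominating the derivative under
  -- the integral.
  obtain ⟨C, hC⟩ := ((isCompact_Icc (a := (-1 : ℝ)) (b := 1)).prod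
    (isCompact_univ (X := sphere (0 : Euc n) 1))).exists_bound_of_continuousOn hF'.continuousOn
  have hder := (hasDerivAt_integral_of_dominated_loc_of_deriv_le
    (μ := (volume : Measure (Euc n)).toSphere) (x₀ := (0 : ℝ)) (s := Icc (-1) 1)
    (F := fun θ (ω : sphere (0 : Euc n) 1) => g (rotate i j θ (ρ • (ω : Euc n))))
    (F' := fun θ (ω : sphere (0 : Euc n) 1) => fderivWithin ℝ g D (rotate i j θ (ρ • (ω : Euc n)))
        (rotateDeriv i j θ (ρ • (ω : Euc n)))) (bound := fun _ => C)
    (Icc_mem_nhds (by norm_num) (by norm_num))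
    (Filter.Eventually.of_forall fun θ =>
      (hF.comp (Continuous.prodMk_right θ)).aestronglyMeasurable)
    (integrable_toSphere (hF.comp (Continuous.prodMk_right 0)))
    (hF'.comp (Continuous.prodMk_right 0)).aestronglyMeasurable
    (Filter.Eventually.of_forall fun ω θ hθ => hC (θ, ω) ⟨hθ, mem_univ _⟩)
    (integrable_const C)
    (Filter.Eventually.of_forall fun ω θ _ => hasDerivAt_comp_of_eventually_mem
      (hg.differentiableOn one_ne_zero _ (hmem θ ω)) (hasDerivAt_rotate i j θ _)
      (Filter.Eventually.of_forall fun τ => hmem τ ω))).2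
  have hconst : (fun θ : ℝ => ∫ ω : sphere (0 : Euc n) 1, g (rotate i j θ (ρ • (ω : Euc n)))
      ∂(volume : Measure (Euc n)).toSphere) = fun _ => ∫ ω : sphere (0 : Euc n) 1,
        g (ρ • (ω : Euc n)) ∂(volume : Measure (Euc n)).toSphere := by
    funext θ
    simp only [rotate_smul]
    have h := integral_toSphere_comp (rotateₗᵢ hij θ) fun x => g (ρ • x)
    simp only [rotateₗᵢ_apply] at h
    exact h
  rw [hconst] at hder
  have hpt : ∀ ω : sphere (0 : Euc n) 1,
      ρ * (ω : Euc n) i * pd D j g (ρ • (ω : Euc n)) - ρ * (ω : Euc n) j * pd D i g (ρ • (ω : Euc n))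
        = fderivWithin ℝ g D (rotate i j 0 (ρ • (ω : Euc n)))
          (rotateDeriv i j 0 (ρ • (ω : Euc n))) := fun ω => by
    simp only [rotate_zero, rotateDeriv, map_add, map_smul, pd]
    simp
    ring
  have h0 := hder.unique (hasDerivAt_const _ _)
  simp only [hpt]
  exact h0

end Sphere

/-! ### Polar coordinates and the divergence theorem on the annulus. -/

section Divergence

variable {n : ℕ}

/-- The integral of `ω ↦ g (ρ ω)` over the unit sphere. -/
noncomputable def sphInt (ρ : ℝ) (g : Euc n → ℝ) : ℝ :=
  ∫ ω : sphere (0 : Euc n) 1, g (ρ • (ω : Euc n)) ∂((volume : Measure (Euc n)).toSphere)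

theorem sphereIntegral_eq (ρ : ℝ) (g : Euc n → ℝ) :
    sphereIntegral ρ g = ρ ^ (n - 1) * sphInt ρ g := rfl

section

variable {r ρ : ℝ} (hρ0 : 0 ≤ ρ) (hρ : ρ ≤ r) {g h : Euc n → ℝ}
include hρ0 hρ

theorem sphInt_add (hg : ContinuousOn g (closedBall 0 r)) (hh : ContinuousOn h (closedBall 0 r)) :
    sphInt ρ (fun x => g x + h x) = sphInt ρ g + sphInt ρ h :=
  integral_add (integrable_toSphere (continuous_comp_smul hρ0 hρ hg))
    (integrable_toSphere (continuous_comp_smul hρ0 hρ hh))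

theorem sphInt_sub (hg : ContinuousOn g (closedBall 0 r)) (hh : ContinuousOn h (closedBall 0 r)) :
    sphInt ρ (fun x => g x - h x) = sphInt ρ g - sphInt ρ h :=
  integral_sub (integrable_toSphere (continuous_comp_smul hρ0 hρ hg))
    (integrable_toSphere (continuous_comp_smul hρ0 hρ hh))

theorem sphInt_sum {ι : Type*} (s : Finset ι) {g : ι → Euc n → ℝ}
    (hg : ∀ i ∈ s, ContinuousOn (g i) (closedBall 0 r)) :
    sphInt ρ (fun x => ∑ i ∈ s, g i x) = ∑ i ∈ s, sphInt ρ (g i) :=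
  integral_finsetSum _ fun i hi => integrable_toSphere (continuous_comp_smul hρ0 hρ (hg i hi))

theorem sphInt_congr (h' : EqOn g h (closedBall 0 r)) : sphInt ρ g = sphInt ρ h :=
  integral_congr_ae (Filter.Eventually.of_forall fun ω => h' (smul_mem_closedBall hρ0 hρ ω))

end

theorem sphInt_const_mul (ρ c : ℝ) (g : Euc n → ℝ) :
    sphInt ρ (fun x => c * g x) = c * sphInt ρ g :=
  integral_const_mul _ _

theorem norm_sq_eq_sum (x : Euc n) : ‖x‖ ^ 2 = ∑ j, x j * x j := by
  rw [EuclideanSpace.norm_sq_eq]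
  simp [sq]

/-- Sum over `j` the vanishing angular derivatives of `x_j h` in the `(j, i)` plane. The term `n -
1` collects `-n x_i h` from the divergence of `x` and `+x_i h` from the diagonal. -/
theorem sphInt_tangential {r ρ : ℝ} (hr : 0 < r) (hρ0 : 0 ≤ ρ) (hρ : ρ ≤ r) {h : Euc n → ℝ}
    (hh : ContDiffOn ℝ 1 h (closedBall 0 r)) (i : Fin n) :
    sphInt ρ (fun x => ‖x‖ ^ 2 * pd (closedBall 0 r) i h x
      - x i * eulerDeriv (closedBall 0 r) h x - ((n : ℝ) - 1) * (x i * h x)) = 0 := by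
  set D := closedBall (0 : Euc n) r
  have hD : UniqueDiffOn ℝ D := uniqueDiffOn_closedBall hr
  have hg : ∀ j, ContDiffOn ℝ 1 (fun x : Euc n => x j * h x) D :=
    fun j => (contDiff_coord j).contDiffOn.mul hh
  have hpg : ∀ i j, ContinuousOn (pd D i fun x : Euc n => x j * h x) D := fun i j =>
    (pd_contDiffOn hD (m := 0) (by exact_mod_cast hg j) i).continuousOn
  have hx : ∀ j, ContinuousOn (fun x : Euc n => x j) D := fun j =>
    (contDiff_coord (m := 0) j).continuous.continuousOn
  have h0 : ∀ j, sphInt ρ (fun x => x j * pd D i (fun x : Euc n => x j * h x) x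
      - x i * pd D j (fun x : Euc n => x j * h x) x) = 0 := fun j => by
    have := integral_toSphere_angularDeriv hr hρ0 hρ (hg j) j i
    simpa [sphInt] using this
  have h1 := sphInt_sum hρ0 hρ Finset.univ (g := fun j x =>
    x j * pd D i (fun x : Euc n => x j * h x) x - x i * pd D j (fun x : Euc n => x j * h x) x)
    fun j _ => ((hx j).mul (hpg i j)).sub ((hx i).mul (hpg j j))
  rw [Finset.sum_eq_zero fun j _ => h0 j] at h1
  rw [← h1]
  refine sphInt_congr hρ0 hρ fun x hx => ?_
  have hd : DifferentiableWithinAt ℝ h D x := hh.differentiableOn one_ne_zero x hx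
  simp only [pd_coord_mul hD hx hd, eulerDeriv_eq_sum, norm_sq_eq_sum, mul_add,
    Finset.sum_sub_distrib, Finset.sum_add_distrib, Finset.sum_mul, Finset.mul_sum, if_true]
  simp only [mul_ite, mul_zero, Finset.sum_ite_eq', Finset.mem_univ, if_true, Finset.sum_const,
    Finset.card_univ, Fintype.card_fin, nsmul_eq_mul, mul_assoc]
  ring

theorem setIntegral_annulus_eq (hn : 1 ≤ n) {r s : ℝ} (hs : 0 ≤ s) (hsr : s ≤ r) {F : Euc n → ℝ}
    (hF : ContinuousOn F (closedBall 0 r)) :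
    ∫ x in ball 0 r \ ball 0 s, F x = ∫ t in s..r, t ^ (n - 1) * sphInt t F := by
  have : Nontrivial (Euc n) := by
    have : Nonempty (Fin n) := ⟨⟨0, hn⟩⟩
    infer_instance
  have hA : MeasurableSet (ball (0 : Euc n) r \ ball 0 s) :=
    measurableSet_ball.diff measurableSet_ball
  -- `F` is controlled only on the closed ball, while the polar decomposition concerns the whole
  -- space; hence the extension by zero.
  set G : Euc n → ℝ := (ball (0 : Euc n) r \ ball 0 s).indicator F with hG
  have hGi : Integrable G := by
    refine (integrable_indicator_iff hA).2 ?_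
    exact (hF.integrableOn_compact (isCompact_closedBall 0 r)).mono_set
      (sdiff_subset.trans ball_subset_closedBall)
  have hmp := (volume : Measure (Euc n)).measurePreserving_homeomorphUnitSphereProd
  have hemb := (homeomorphUnitSphereProd (Euc n)).measurableEmbedding
  set P : sphere (0 : Euc n) 1 × Ioi (0 : ℝ) → ℝ := fun p => G (p.2.1 • (p.1 : Euc n)) with hP
  have hcomp : ∀ x : ({(0)}ᶜ : Set (Euc n)), P (homeomorphUnitSphereProd (Euc n) x) = G x := by
    intro x
    have hx : ‖(x : Euc n)‖ ≠ 0 := norm_ne_zero_iff.2 x.2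
    simp [hP, smul_smul, hx]
  have hPi : Integrable P ((volume : Measure (Euc n)).toSphere.prod
      (.volumeIoiPow (Module.finrank ℝ (Euc n) - 1))) := by
    rw [← hmp.integrable_comp_emb hemb]
    have h1 : P ∘ homeomorphUnitSphereProd (Euc n) = G ∘ Subtype.val := funext hcomp
    rw [h1, ← integrableOn_iff_comap_subtypeVal (measurableSet_singleton _).compl]
    exact hGi.integrableOn
  have hfin : Module.finrank ℝ (Euc n) = n := by simp
  calc ∫ x in ball 0 r \ ball 0 s, F x = ∫ x, G x := (integral_indicator hA).symm
    _ = ∫ x : ({(0)}ᶜ : Set (Euc n)), G x.1 ∂((volume : Measure (Euc n)).comap (↑)) := by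
      rw [integral_subtype_comap (measurableSet_singleton _).compl fun x => G x,
        restrict_compl_singleton]
    _ = ∫ p, P p ∂((volume : Measure (Euc n)).toSphere.prod
        (.volumeIoiPow (Module.finrank ℝ (Euc n) - 1))) := by
      rw [← hmp.integral_comp hemb]
      exact integral_congr_ae (Filter.Eventually.of_forall fun x => (hcomp x).symm)
    _ = ∫ t : Ioi (0 : ℝ), sphInt t.1 G ∂(.volumeIoiPow (n - 1)) := by
      rw [integral_prod_symm _ hPi, hfin]
      rfl
    _ = ∫ t in Ioi (0 : ℝ), t ^ (n - 1) * sphInt t G := by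
      simp only [Measure.volumeIoiPow, ENNReal.ofReal]
      rw [integral_withDensity_eq_integral_smul,
        integral_subtype_comap measurableSet_Ioi
          fun a => Real.toNNReal (a ^ (n - 1)) • sphInt a G,
        setIntegral_congr_fun measurableSet_Ioi fun x hx => ?_]
      · simp only [NNReal.smul_def, Real.coe_toNNReal _ (pow_nonneg (mem_Ioi.1 hx).le _),
          smul_eq_mul]
      · exact (measurable_subtype_coe.pow_const _).real_toNNReal
    _ = ∫ t in Ioi (0 : ℝ), (Ico s r).indicator (fun t => t ^ (n - 1) * sphInt t F) t := by
      refine setIntegral_congr_fun measurableSet_Ioi fun t ht => ?_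
      have ht0 : 0 < t := ht
      have hmem : ∀ ω : sphere (0 : Euc n) 1, t • (ω : Euc n) ∈ ball (0 : Euc n) r \ ball 0 s ↔
          t ∈ Ico s r := fun ω => by
        simp [norm_smul, abs_of_pos ht0, and_comm]
      simp only [sphInt, hG, indicator, hmem]
      split_ifs <;> simp
    _ = ∫ t in s..r, t ^ (n - 1) * sphInt t F := by
      rw [setIntegral_indicator measurableSet_Ico, intervalIntegral.integral_of_le hsr,
        ← integral_Ico_eq_integral_Ioc]
      refine setIntegral_congr_set ?_
      -- For `s = 0` the interval `Ico s r` contains the origin, which `Ioi 0` misses; a single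
      -- point is negligible.
      have h := (Ioi_ae_eq_Ici (μ := volume) (a := (0 : ℝ))).inter
        (Filter.EventuallyEq.refl (ae volume) (Ico s r))
      rwa [inter_eq_right.2 fun t ht => mem_Ici.2 (hs.trans ht.1)] at h

theorem hasDerivAt_radial {r t : ℝ} {h : Euc n → ℝ} (hh : ContDiffOn ℝ 1 h (closedBall 0 r))
    (ht0 : 0 < t) (ht : t < r) (ω : sphere (0 : Euc n) 1) :
    HasDerivAt (fun t : ℝ => h (t • (ω : Euc n)))
      (fderivWithin ℝ h (closedBall 0 r) (t • (ω : Euc n)) ω) t := by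
  have hc : HasDerivAt (fun t : ℝ => t • (ω : Euc n)) (ω : Euc n) t := by
    simpa using (hasDerivAt_id t).smul_const (ω : Euc n)
  refine hasDerivAt_comp_of_eventually_mem
    (hh.differentiableOn one_ne_zero _ (smul_mem_closedBall ht0.le ht.le ω)) hc ?_
  filter_upwards [Ioo_mem_nhds ht0 ht] with τ hτ using smul_mem_closedBall hτ.1.le hτ.2.le ω

/-- By `sphInt_tangential`, `t ^ (n - 1)` times the spherical integral of `∂ᵢ h` is the
`t`-derivative of the flux of `h eᵢ` through the sphere of radius `t`. -/
theorem setIntegral_annulus_pd (hn : 1 ≤ n) {r s : ℝ} (hr : 0 < r) (hs : 0 ≤ s) (hsr : s ≤ r)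
    {h : Euc n → ℝ} (hh : ContDiffOn ℝ 1 h (closedBall 0 r)) (i : Fin n) :
    ∫ x in ball 0 r \ ball 0 s, pd (closedBall 0 r) i h x
      = r ^ (n - 1) * (∫ ω : sphere (0 : Euc n) 1, (ω : Euc n) i * h (r • (ω : Euc n))
          ∂((volume : Measure (Euc n)).toSphere))
        - s ^ (n - 1) * ∫ ω : sphere (0 : Euc n) 1, (ω : Euc n) i * h (s • (ω : Euc n))
          ∂((volume : Measure (Euc n)).toSphere) := by
  set D := closedBall (0 : Euc n) r
  have hD : UniqueDiffOn ℝ D := uniqueDiffOn_closedBall hr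
  have hpc : ContinuousOn (pd D i h) D :=
    (pd_contDiffOn hD (m := 0) (by exact_mod_cast hh) i).continuousOn
  have hEc : ContinuousOn (eulerDeriv D h) D :=
    (eulerDeriv_contDiffOn hD (m := 0) (by exact_mod_cast hh)).continuousOn
  have hxc : ContinuousOn (fun x : Euc n => x i) D :=
    (contDiff_coord (m := 0) i).continuous.continuousOn
  have hdc : ContinuousOn (fderivWithin ℝ h D) D := hh.continuousOn_fderivWithin hD le_rfl
  -- `K t ω` is the derivative in `t` of `t ^ (n - 1) * (ωᵢ h (t ω))`.
  set K : ℝ → sphere (0 : Euc n) 1 → ℝ := fun t ω =>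
    ((n - 1 : ℕ) : ℝ) * t ^ (n - 1 - 1) * ((ω : Euc n) i * h (t • (ω : Euc n)))
      + t ^ (n - 1) * ((ω : Euc n) i * fderivWithin ℝ h D (t • (ω : Euc n)) ω) with hK
  have hmaps : MapsTo (fun p : ℝ × sphere (0 : Euc n) 1 => p.1 • (p.2 : Euc n))
      (Icc s r ×ˢ univ) D := fun p hp => smul_mem_closedBall (hs.trans hp.1.1) hp.1.2 p.2
  have hsm : ContinuousOn (fun p : ℝ × sphere (0 : Euc n) 1 => p.1 • (p.2 : Euc n))
      (Icc s r ×ˢ univ) := by fun_prop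
  have hω : Continuous fun p : ℝ × sphere (0 : Euc n) 1 => (p.2 : Euc n) := by fun_prop
  have hωi : Continuous fun p : ℝ × sphere (0 : Euc n) 1 => (p.2 : Euc n) i := by fun_prop
  have hKc : ContinuousOn (fun p : ℝ × sphere (0 : Euc n) 1 => K p.1 p.2) (Icc s r ×ˢ univ) := by
    have h1 := hh.continuousOn.comp hsm hmaps
    have h2 := (hdc.comp hsm hmaps).clm_apply hω.continuousOn
    refine ContinuousOn.add ?_ ?_
    · exact (by fun_prop : Continuous fun p : ℝ × sphere (0 : Euc n) 1 =>
        ((n - 1 : ℕ) : ℝ) * p.1 ^ (n - 1 - 1)).continuousOn.mul (hωi.continuousOn.mul h1)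
    · exact (by fun_prop : Continuous fun p : ℝ × sphere (0 : Euc n) 1 =>
        p.1 ^ (n - 1)).continuousOn.mul (hωi.continuousOn.mul h2)
  have hKt : ∀ ω, ContinuousOn (fun t => K t ω) (Icc s r) := fun ω =>
    hKc.comp (Continuous.prodMk_left ω).continuousOn fun t ht => ⟨ht, mem_univ _⟩
  have hstep : ∀ t ∈ Ioc s r, t ^ (n - 1) * sphInt t (pd D i h)
      = ∫ ω, K t ω ∂((volume : Measure (Euc n)).toSphere) := by
    intro t ht
    have ht0 : 0 < t := hs.trans_lt ht.1
    have hT := sphInt_tangential hr ht0.le ht.2 hh i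
    have c1 : ContinuousOn (fun x : Euc n => ‖x‖ ^ 2 * pd D i h x) D :=
      (continuous_norm.pow 2).continuousOn.mul hpc
    have c2 : ContinuousOn (fun x : Euc n => x i * eulerDeriv D h x) D := hxc.mul hEc
    have c3 : ContinuousOn (fun x : Euc n => ((n : ℝ) - 1) * (x i * h x)) D :=
      continuousOn_const.mul (hxc.mul hh.continuousOn)
    have c12 : ContinuousOn (fun x : Euc n => ‖x‖ ^ 2 * pd D i h x - x i * eulerDeriv D h x) D :=
      c1.sub c2
    rw [sphInt_sub ht0.le ht.2 c12 c3, sphInt_sub ht0.le ht.2 c1 c2, sphInt_const_mul] at hT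
    have e1 : sphInt t (fun x => ‖x‖ ^ 2 * pd D i h x) = t ^ 2 * sphInt t (pd D i h) := by
      simp [sphInt, norm_smul, integral_const_mul]
    have e2 : sphInt t (fun x => x i * eulerDeriv D h x) = t ^ 2 *
        ∫ ω : sphere (0 : Euc n) 1, (ω : Euc n) i * fderivWithin ℝ h D (t • (ω : Euc n)) ω
          ∂((volume : Measure (Euc n)).toSphere) := by
      simp only [sphInt, eulerDeriv, map_smul, ← integral_const_mul]
      congr 1
      funext ω
      simp
      ring
    have e3 : sphInt t (fun x => x i * h x) = t *
        ∫ ω : sphere (0 : Euc n) 1, (ω : Euc n) i * h (t • (ω : Euc n))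
          ∂((volume : Measure (Euc n)).toSphere) := by
      simp only [sphInt, ← integral_const_mul]
      congr 1
      funext ω
      simp
      ring
    rw [e1, e2, e3] at hT
    have hi1 : Continuous fun ω : sphere (0 : Euc n) 1 => (ω : Euc n) i * h (t • (ω : Euc n)) :=
      (by fun_prop : Continuous fun ω : sphere (0 : Euc n) 1 => (ω : Euc n) i).mul
        (continuous_comp_smul ht0.le ht.2 hh.continuousOn)
    have hi2 : Continuous fun ω : sphere (0 : Euc n) 1 =>
        (ω : Euc n) i * fderivWithin ℝ h D (t • (ω : Euc n)) ω :=
      (by fun_prop : Continuous fun ω : sphere (0 : Euc n) 1 => (ω : Euc n) i).mul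
        ((hdc.comp_continuous (by fun_prop) (smul_mem_closedBall ht0.le ht.2)).clm_apply
          continuous_subtype_val)
    simp only [hK]
    rw [integral_add (integrable_toSphere (hi1.const_mul _))
      (integrable_toSphere (hi2.const_mul _)), integral_const_mul, integral_const_mul]
    set I1 := ∫ ω : sphere (0 : Euc n) 1, (ω : Euc n) i * h (t • (ω : Euc n))
          ∂((volume : Measure (Euc n)).toSphere)
    set I2 := ∫ ω : sphere (0 : Euc n) 1, (ω : Euc n) i * fderivWithin ℝ h D (t • (ω : Euc n)) ω
          ∂((volume : Measure (Euc n)).toSphere)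
    have hT' : t * sphInt t (pd D i h) = t * I2 + ((n : ℝ) - 1) * I1 :=
      mul_left_cancel₀ ht0.ne' (by linear_combination hT)
    -- For `n = 1` the exponent `n - 1 - 1` is truncated, but its coefficient `n - 1` is zero.
    obtain ⟨m, rfl⟩ := Nat.exists_eq_add_of_le' hn
    rcases m with _ | m
    · have := mul_left_cancel₀ ht0.ne' (b := sphInt t (pd D i h)) (c := I2)
        (by rw [hT']; simp)
      simp [this]
    · simp only [Nat.add_sub_cancel]
      push_cast at hT' ⊢
      rw [pow_succ]
      linear_combination t ^ m * hT'
  have hFTC : ∀ ω : sphere (0 : Euc n) 1, ∫ t in s..r, K t ω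
      = r ^ (n - 1) * ((ω : Euc n) i * h (r • (ω : Euc n)))
        - s ^ (n - 1) * ((ω : Euc n) i * h (s • (ω : Euc n))) := fun ω => by
    refine intervalIntegral.integral_eq_sub_of_hasDerivAt_of_le hsr
      (f := fun t => t ^ (n - 1) * ((ω : Euc n) i * h (t • (ω : Euc n)))) ?_ ?_ ?_
    · refine (by fun_prop : Continuous fun t : ℝ => t ^ (n - 1)).continuousOn.mul
        (continuousOn_const.mul (hh.continuousOn.comp (by fun_prop) fun t ht =>
          smul_mem_closedBall (hs.trans ht.1) ht.2 ω))
    · intro t ht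
      exact (hasDerivAt_pow (n - 1) t).mul
        ((hasDerivAt_radial hh (hs.trans_lt ht.1) ht.2 ω).const_mul _)
    · rw [intervalIntegrable_iff_integrableOn_Icc_of_le hsr]
      exact (hKt ω).integrableOn_compact isCompact_Icc
  have hcs : ∀ ρ, 0 ≤ ρ → ρ ≤ r → Integrable (fun ω : sphere (0 : Euc n) 1 =>
      ρ ^ (n - 1) * ((ω : Euc n) i * h (ρ • (ω : Euc n)))) (volume : Measure (Euc n)).toSphere :=
    fun ρ h0 h1 => integrable_toSphere (((by fun_prop : Continuous fun ω : sphere (0 : Euc n) 1 =>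
      (ω : Euc n) i).mul (continuous_comp_smul h0 h1 hh.continuousOn)).const_mul _)
  rw [setIntegral_annulus_eq hn hs hsr hpc, intervalIntegral.integral_of_le hsr,
    setIntegral_congr_fun measurableSet_Ioc hstep, integral_integral_swap]
  · simp only [← intervalIntegral.integral_of_le hsr, hFTC]
    rw [integral_sub (hcs r hr.le le_rfl) (hcs s hs hsr), integral_const_mul, integral_const_mul]
  -- Fubini applies because `K` is continuous on the compact set `[s, r]` times the sphere.
  · have h1 := hKc.integrableOn_compact (μ := (volume : Measure ℝ).prod
      (volume : Measure (Euc n)).toSphere) (isCompact_Icc.prod isCompact_univ)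
    have h2 := h1.mono_set (prod_mono_left Ioc_subset_Icc_self)
    rwa [IntegrableOn, ← Measure.prod_restrict, Measure.restrict_univ] at h2

end Divergence

/-! ### Fluxes, Green's formula and its iteration. -/

section Green

variable {n : ℕ}

/-- The flux of the vector field `H` through the sphere of radius `ρ` centred at the origin. -/
noncomputable def flux (ρ : ℝ) (H : Fin n → Euc n → ℝ) : ℝ :=
  ρ ^ (n - 1) * ∫ ω : sphere (0 : Euc n) 1, ∑ i, (ω : Euc n) i * H i (ρ • (ω : Euc n))
    ∂((volume : Measure (Euc n)).toSphere)

theorem integrableOn_annulus {r s : ℝ} {g : Euc n → ℝ} (hg : ContinuousOn g (closedBall 0 r)) :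
    IntegrableOn g (ball 0 r \ ball 0 s) :=
  (hg.integrableOn_compact (isCompact_closedBall 0 r)).mono_set
    (sdiff_subset.trans ball_subset_closedBall)

theorem setIntegral_annulus_congr {r s : ℝ} {g h : Euc n → ℝ} (H : EqOn g h (closedBall 0 r)) :
    ∫ x in ball 0 r \ ball 0 s, g x = ∫ x in ball 0 r \ ball 0 s, h x :=
  setIntegral_congr_fun (measurableSet_ball.diff measurableSet_ball)
    (H.mono (sdiff_subset.trans ball_subset_closedBall))

theorem setIntegral_annulus_div (hn : 1 ≤ n) {r s : ℝ} (hr : 0 < r) (hs : 0 ≤ s) (hsr : s ≤ r)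
    {H : Fin n → Euc n → ℝ} (hH : ∀ i, ContDiffOn ℝ 1 (H i) (closedBall 0 r)) :
    ∫ x in ball 0 r \ ball 0 s, ∑ i, pd (closedBall 0 r) i (H i) x = flux r H - flux s H := by
  have hD := uniqueDiffOn_closedBall (n := n) hr
  have hi : ∀ ρ, 0 ≤ ρ → ρ ≤ r → ∀ i, Integrable (fun ω : sphere (0 : Euc n) 1 =>
      (ω : Euc n) i * H i (ρ • (ω : Euc n))) (volume : Measure (Euc n)).toSphere :=
    fun ρ h0 h1 i => integrable_toSphere ((by fun_prop : Continuous fun ω : sphere (0 : Euc n) 1 =>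
      (ω : Euc n) i).mul (continuous_comp_smul h0 h1 (hH i).continuousOn))
  rw [integral_finsetSum _ fun i _ => integrableOn_annulus
    (pd_contDiffOn hD (m := 0) (by exact_mod_cast hH i) i).continuousOn]
  simp only [setIntegral_annulus_pd hn hr hs hsr (hH _)]
  simp only [flux]
  rw [integral_finsetSum _ fun i _ => hi r hr.le le_rfl i,
    integral_finsetSum _ fun i _ => hi s hs hsr i, Finset.sum_sub_distrib, Finset.mul_sum,
    Finset.mul_sum]

/-- For `n = 1` the factor `0 ^ (n - 1)` equals `1`, so the vanishing must come from the oddness of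
`ω ↦ ∑ ωᵢ Hᵢ(0)`. -/
theorem flux_zero (H : Fin n → Euc n → ℝ) : flux 0 H = 0 := by
  have h := integral_toSphere_of_odd (n := n) (g := fun x => ∑ i, x i * H i 0) fun x => by
    simp [Finset.sum_neg_distrib]
  simp only [flux, zero_smul]
  rw [h, mul_zero]

theorem sum_sphere_mul_self (ω : sphere (0 : Euc n) 1) :
    ∑ i, (ω : Euc n) i * (ω : Euc n) i = 1 := by
  rw [← norm_sq_eq_sum]
  simp

theorem normalDeriv_smul {ρ : ℝ} (hρ : 0 < ρ) (D : Set (Euc n)) (v : Euc n → ℝ)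
    (ω : sphere (0 : Euc n) 1) :
    normalDeriv D v (ρ • (ω : Euc n)) = ∑ i, (ω : Euc n) i * pd D i v (ρ • (ω : Euc n)) := by
  rw [normalDeriv, ← fderivWithin_eq_sum_pd]
  congr 1
  simp [norm_smul, abs_of_pos hρ, smul_smul, hρ.ne']

theorem normalDeriv_zero (D : Set (Euc n)) (v : Euc n → ℝ) : normalDeriv D v 0 = 0 := by
  simp [normalDeriv]

theorem sphereIntegral_zero_of_eq_zero {g : Euc n → ℝ} (hg : g 0 = 0) :
    sphereIntegral 0 g = 0 := by
  simp [sphereIntegral, hg]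

theorem flux_gradient_sub {ρ : ℝ} (hρ : 0 ≤ ρ) (D : Set (Euc n)) (a b v w : Euc n → ℝ) :
    flux ρ (fun i x => a x * pd D i v x - b x * pd D i w x)
      = sphereIntegral ρ (fun x => normalDeriv D v x * a x - b x * normalDeriv D w x) := by
  rcases hρ.eq_or_lt with rfl | hρ
  -- At radius zero the right side vanishes because `‖0‖⁻¹ • 0 = 0` makes every `normalDeriv` zero
  -- at the origin.
  · rw [flux_zero, sphereIntegral_zero_of_eq_zero (by simp [normalDeriv_zero])]
  · simp only [flux, sphereIntegral, normalDeriv_smul hρ]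
    congr 2
    funext ω
    simp only [Finset.sum_mul, Finset.mul_sum, ← Finset.sum_sub_distrib]
    exact Finset.sum_congr rfl fun i _ => by ring

/-- Divergence theorem for the field `x g`. It serves both `g = w ^ 2` for even `k` and `g = f
|u|^p`. -/
theorem setIntegral_annulus_radial (hn : 1 ≤ n) {r s : ℝ} (hr : 0 < r) (hs : 0 ≤ s) (hsr : s ≤ r)
    {g : Euc n → ℝ} (hg : ContDiffOn ℝ 1 g (closedBall 0 r)) :
    ∫ x in ball 0 r \ ball 0 s, (n * g x + eulerDeriv (closedBall 0 r) g x)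
      = r * sphereIntegral r g - s * sphereIntegral s g := by
  have hD := uniqueDiffOn_closedBall (n := n) hr
  have hflux : ∀ ρ, flux ρ (fun i (x : Euc n) => x i * g x) = ρ * sphereIntegral ρ g := fun ρ => by
    simp only [flux, sphereIntegral]
    rw [mul_left_comm]
    congr 1
    rw [← integral_const_mul]
    congr 1
    funext ω
    refine Eq.trans ?_ ((congrArg (ρ * g (ρ • (ω : Euc n)) * ·) (sum_sphere_mul_self ω)).trans
      (mul_one _))
    simp only [Finset.mul_sum]
    exact Finset.sum_congr rfl fun i _ => by simp; ring
  rw [← hflux, ← hflux, ← setIntegral_annulus_div hn hr hs hsr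
    fun i => (contDiff_coord i).contDiffOn.mul hg]
  refine setIntegral_annulus_congr fun x hx => ?_
  simp only [pd_coord_mul hD hx (hg.differentiableOn one_ne_zero x hx), eulerDeriv_eq_sum,
    Finset.sum_add_distrib]
  simp [add_comm]

theorem setIntegral_annulus_green (hn : 1 ≤ n) {r s : ℝ} (hr : 0 < r) (hs : 0 ≤ s) (hsr : s ≤ r)
    {v w : Euc n → ℝ} (hv : ContDiffOn ℝ 2 v (closedBall 0 r))
    (hw : ContDiffOn ℝ 2 w (closedBall 0 r)) :
    ∫ x in ball 0 r \ ball 0 s, (v x * -(Δ[closedBall 0 r] w) x - -(Δ[closedBall 0 r] v) x * w x)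
      = sphereIntegral r (fun x => normalDeriv (closedBall 0 r) v x * w x
          - v x * normalDeriv (closedBall 0 r) w x)
        - sphereIntegral s (fun x => normalDeriv (closedBall 0 r) v x * w x
          - v x * normalDeriv (closedBall 0 r) w x) := by
  set D := closedBall (0 : Euc n) r
  have hD : UniqueDiffOn ℝ D := uniqueDiffOn_closedBall hr
  have hv1 : ∀ i, ContDiffOn ℝ 1 (pd D i v) D := fun i => by
    exact_mod_cast pd_contDiffOn hD (m := 1) (by exact_mod_cast hv) i
  have hw1 : ∀ i, ContDiffOn ℝ 1 (pd D i w) D := fun i => by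
    exact_mod_cast pd_contDiffOn hD (m := 1) (by exact_mod_cast hw) i
  have hv' := hv.of_le one_le_two
  have hw' := hw.of_le one_le_two
  rw [← flux_gradient_sub hr.le, ← flux_gradient_sub hs, ← setIntegral_annulus_div hn hr hs hsr
    (H := fun i x => w x * pd D i v x - v x * pd D i w x)
    fun i => (hw'.mul (hv1 i)).sub (hv'.mul (hw1 i))]
  refine setIntegral_annulus_congr fun x hx => ?_
  have d : ∀ {g : Euc n → ℝ}, ContDiffOn ℝ 1 g D → DifferentiableWithinAt ℝ g D x :=
    fun h => h.differentiableOn one_ne_zero x hx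
  simp only [laplacianWithin_eq_sum hD hv hx, laplacianWithin_eq_sum hD hw hx]
  have : ∀ i, pd D i (fun y => w y * pd D i v y - v y * pd D i w y) x
      = w x * pd D i (pd D i v) x - v x * pd D i (pd D i w) x := fun i => by
    rw [pd_sub hD hx ((d hw').fun_mul (d (hv1 i))) ((d hv').fun_mul (d (hw1 i))),
      pd_mul hD hx (d hw') (d (hv1 i)), pd_mul hD hx (d hv') (d (hw1 i))]
    ring
  refine Eq.trans ?_ (Finset.sum_congr rfl fun i _ => this i).symm
  simp only [Finset.sum_sub_distrib, ← Finset.mul_sum]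
  ring

/-- Each application of Green's formula transfers one Laplacian to `X`. Only `2 * m` derivatives of
`X` are used, which later allows `X` to be an Euler derivative. -/
theorem setIntegral_annulus_mul_polyLap (hn : 1 ≤ n) {r s : ℝ} (hr : 0 < r) (hs : 0 ≤ s)
    (hsr : s ≤ r) {k m : ℕ} (hm : m ≤ k) {X u : Euc n → ℝ}
    (hX : ContDiffOn ℝ (2 * m : ℕ) X (closedBall 0 r))
    (hu : ContDiffOn ℝ (2 * k : ℕ) u (closedBall 0 r)) :
    ∫ x in ball 0 r \ ball 0 s, X x * polyLap (closedBall 0 r) k u x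
      = (∫ x in ball 0 r \ ball 0 s,
          polyLap (closedBall 0 r) m X x * polyLap (closedBall 0 r) (k - m) u x)
        + ∑ i ∈ Finset.range m, (sphereIntegral r (fun x =>
            normalDeriv (closedBall 0 r) (polyLap (closedBall 0 r) i X) x
                * polyLap (closedBall 0 r) (k - i - 1) u x
              - polyLap (closedBall 0 r) i X x
                * normalDeriv (closedBall 0 r) (polyLap (closedBall 0 r) (k - i - 1) u) x)
          - sphereIntegral s (fun x =>
            normalDeriv (closedBall 0 r) (polyLap (closedBall 0 r) i X) x
                * polyLap (closedBall 0 r) (k - i - 1) u x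
              - polyLap (closedBall 0 r) i X x
                * normalDeriv (closedBall 0 r) (polyLap (closedBall 0 r) (k - i - 1) u) x)) := by
  have hD : UniqueDiffOn ℝ (closedBall (0 : Euc n) r) := uniqueDiffOn_closedBall hr
  induction m with
  | zero => simp [polyLap_zero]
  | succ m ih =>
    have hX' : ∀ i ≤ m + 1, ContinuousOn (polyLap (closedBall 0 r) i X) (closedBall 0 r) :=
      fun i hi => (polyLap_contDiffOn hD i (m := 0)
        (hX.of_le (by norm_cast; lia))).continuousOn
    have hu' : ∀ i ≤ k, ContinuousOn (polyLap (closedBall 0 r) i u) (closedBall 0 r) :=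
      fun i hi => (polyLap_contDiffOn hD i (m := 0)
        (hu.of_le (by norm_cast; lia))).continuousOn
    have hv : ContDiffOn ℝ 2 (polyLap (closedBall 0 r) m X) (closedBall 0 r) := by
      exact_mod_cast polyLap_contDiffOn hD m (m := 2) (hX.of_le (by norm_cast; lia))
    have hw : ContDiffOn ℝ 2 (polyLap (closedBall 0 r) (k - m - 1) u) (closedBall 0 r) := by
      exact_mod_cast polyLap_contDiffOn hD (k - m - 1) (m := 2) (hu.of_le (by norm_cast; lia))
    have hg := setIntegral_annulus_green hn hr hs hsr hv hw
    have e1 : ∀ x, -(Δ[closedBall 0 r] (polyLap (closedBall 0 r) m X)) x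
        = polyLap (closedBall 0 r) (m + 1) X x := fun x => (congrFun (polyLap_succ _ m X) x).symm
    have e2 : ∀ x, -(Δ[closedBall 0 r] (polyLap (closedBall 0 r) (k - m - 1) u)) x
        = polyLap (closedBall 0 r) (k - m) u x := fun x => by
      rw [← congrFun (polyLap_succ _ (k - m - 1) u) x, show k - m - 1 + 1 = k - m by lia]
    simp only [e1, e2] at hg
    have i1 : IntegrableOn (fun x => polyLap (closedBall 0 r) m X x
        * polyLap (closedBall 0 r) (k - m) u x) (ball 0 r \ ball 0 s) :=
      integrableOn_annulus ((hX' m (by lia)).mul (hu' _ (by lia)))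
    have i2 : IntegrableOn (fun x => polyLap (closedBall 0 r) (m + 1) X x
        * polyLap (closedBall 0 r) (k - m - 1) u x) (ball 0 r \ ball 0 s) :=
      integrableOn_annulus ((hX' (m + 1) (by lia)).mul (hu' _ (by lia)))
    rw [integral_sub i1 i2] at hg
    rw [ih (by lia) (hX.of_le (by norm_cast; lia)), Finset.sum_range_succ, ← hg,
      show k - (m + 1) = k - m - 1 by lia]
    ring

end Green

/-! ### The Pohozaev field of a second-order problem and its flux. -/

section Pohozaev

variable {n : ℕ}

theorem normalDeriv_smul_eq {ρ : ℝ} (hρ : 0 < ρ) (D : Set (Euc n)) (v : Euc n → ℝ)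
    (ω : sphere (0 : Euc n) 1) :
    ρ * normalDeriv D v (ρ • (ω : Euc n)) = eulerDeriv D v (ρ • (ω : Euc n)) := by
  rw [normalDeriv_smul hρ, eulerDeriv_eq_sum, Finset.mul_sum]
  exact Finset.sum_congr rfl fun i _ => by simp; ring

/-- The vector field whose divergence is `((n - 2) / 2 w + ⟨x, ∇w⟩) Δ₀ w`. -/
noncomputable def pohozaevField (D : Set (Euc n)) (w : Euc n → ℝ) (i : Fin n) (x : Euc n) : ℝ :=
  x i * (1 / 2 * ∑ j, pd D j w x * pd D j w x)
    - (((n : ℝ) - 2) / 2 * w x + eulerDeriv D w x) * pd D i w x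

variable {r : ℝ} {w : Euc n → ℝ}

theorem pohozaevField_contDiffOn {D : Set (Euc n)} (hD : UniqueDiffOn ℝ D)
    (hw : ContDiffOn ℝ 2 w D) (i : Fin n) : ContDiffOn ℝ 1 (pohozaevField D w i) D := by
  have hp : ∀ i, ContDiffOn ℝ 1 (pd D i w) D := fun i => by
    exact_mod_cast pd_contDiffOn hD (m := 1) (by exact_mod_cast hw) i
  have hE : ContDiffOn ℝ 1 (eulerDeriv D w) D := by
    exact_mod_cast eulerDeriv_contDiffOn hD (m := 1) (by exact_mod_cast hw)
  exact ((contDiff_coord i).contDiffOn.mul (contDiffOn_const.mul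
    (ContDiffOn.sum fun j _ => (hp j).mul (hp j)))).sub
    (((contDiffOn_const.mul (hw.of_le one_le_two)).add hE).mul (hp i))

/-- The Hessian terms `⟨x, D²w ∇w⟩` cancel. The coefficient `(n - 2) / 2` is the one for which the
`|∇w|²` terms cancel too: `n / 2` from `x |∇w|² / 2` against `(n - 2) / 2 + 1` from the other part.
-/
theorem sum_pd_pohozaevField {D : Set (Euc n)} (hD : UniqueDiffOn ℝ D)
    (hc : D ⊆ closure (interior D)) (hw : ContDiffOn ℝ 2 w D) {x : Euc n} (hx : x ∈ D) :
    ∑ i, pd D i (pohozaevField D w i) x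
      = (((n : ℝ) - 2) / 2 * w x + eulerDeriv D w x) * -(Δ[D] w) x := by
  have hp : ∀ i, ContDiffOn ℝ 1 (pd D i w) D := fun i => by
    exact_mod_cast pd_contDiffOn hD (m := 1) (by exact_mod_cast hw) i
  have hE : ContDiffOn ℝ 1 (eulerDeriv D w) D := by
    exact_mod_cast eulerDeriv_contDiffOn hD (m := 1) (by exact_mod_cast hw)
  have d : ∀ {g : Euc n → ℝ}, ContDiffOn ℝ 1 g D → DifferentiableWithinAt ℝ g D x :=
    fun h => h.differentiableOn one_ne_zero x hx
  have dw := d (hw.of_le one_le_two)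
  have dp := fun i => d (hp i)
  have dN : DifferentiableWithinAt ℝ (fun y => ∑ j, pd D j w y * pd D j w y) D x :=
    DifferentiableWithinAt.fun_sum fun j _ => (dp j).fun_mul (dp j)
  have dcN : DifferentiableWithinAt ℝ (fun y => 1 / 2 * ∑ j, pd D j w y * pd D j w y) D x :=
    (differentiableWithinAt_const _).fun_mul dN
  have dcw : DifferentiableWithinAt ℝ (fun y => ((n : ℝ) - 2) / 2 * w y) D x :=
    (differentiableWithinAt_const _).fun_mul dw
  have dT : DifferentiableWithinAt ℝ (fun y => ((n : ℝ) - 2) / 2 * w y + eulerDeriv D w y) D x :=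
    dcw.fun_add (d hE)
  have h : ∀ i, pd D i (pohozaevField D w i) x
      = x i * ∑ j, pd D j w x * pd D i (pd D j w) x + 1 / 2 * ∑ j, pd D j w x * pd D j w x
        - ((((n : ℝ) - 2) / 2 * w x + eulerDeriv D w x) * pd D i (pd D i w) x
          + pd D i w x * (n / 2 * pd D i w x + ∑ j, x j * pd D i (pd D j w) x)) := fun i => by
    unfold pohozaevField
    rw [pd_sub hD hx ((differentiableWithinAt_coord i).fun_mul dcN) (dT.fun_mul (dp i)),
      pd_coord_mul hD hx dcN, pd_const_mul hD hx _ dN,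
      pd_sum _ hD hx fun j _ => (dp j).fun_mul (dp j), pd_mul hD hx dT (dp i),
      pd_add hD hx dcw (d hE), pd_const_mul hD hx _ dw, pd_eulerDeriv hD hw hx]
    simp only [pd_mul hD hx (dp _) (dp _), ← two_mul, ← Finset.mul_sum, if_true]
    ring
  have hsymm : ∑ i, pd D i w x * ∑ j, x j * pd D i (pd D j w) x
      = ∑ i, x i * ∑ j, pd D j w x * pd D i (pd D j w) x := by
    simp only [Finset.mul_sum]
    rw [Finset.sum_comm]
    refine Finset.sum_congr rfl fun i _ => Finset.sum_congr rfl fun j _ => ?_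
    rw [pd_comm hD hc hw hx]
    ring
  simp only [h, laplacianWithin_eq_sum hD hw hx, Finset.sum_sub_distrib, Finset.sum_add_distrib,
    mul_add (pd D _ w x), hsymm, ← Finset.mul_sum, Finset.sum_const, Finset.card_univ,
    Fintype.card_fin, nsmul_eq_mul, mul_left_comm (pd D _ w x)]
  ring

/-- The difference of the two integrands is, pointwise, the expression of `sphInt_tangential` for `h
= w ∂ᵢ w` summed over `i`. This trades `|∇w|²` for `w Δ₀ w` and radial derivatives. -/
theorem sphInt_pohozaevField {ρ : ℝ} (hr : 0 < r) (hρ0 : 0 ≤ ρ) (hρ : ρ ≤ r)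
    (hw : ContDiffOn ℝ 2 w (closedBall 0 r)) :
    sphInt ρ (fun x => 2 * ∑ i, x i * pohozaevField (closedBall 0 r) w i x)
      = sphInt ρ (fun x => ‖x‖ ^ 2 * (-(Δ[closedBall 0 r] w) x * w x)
        + (w x * eulerDeriv (closedBall 0 r) (eulerDeriv (closedBall 0 r) w) x
          - eulerDeriv (closedBall 0 r) w x * eulerDeriv (closedBall 0 r) w x)) := by
  set D := closedBall (0 : Euc n) r
  have hD : UniqueDiffOn ℝ D := uniqueDiffOn_closedBall hr
  have hc : D ⊆ closure (interior D) := closedBall_subset_closure_interior hr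
  have hp : ∀ i, ContDiffOn ℝ 1 (pd D i w) D := fun i => by
    exact_mod_cast pd_contDiffOn hD (m := 1) (by exact_mod_cast hw) i
  have hw1 := hw.of_le one_le_two
  have hE : ContDiffOn ℝ 1 (eulerDeriv D w) D := by
    exact_mod_cast eulerDeriv_contDiffOn hD (m := 1) (by exact_mod_cast hw)
  have hEE : ContinuousOn (eulerDeriv D (eulerDeriv D w)) D :=
    (eulerDeriv_contDiffOn hD (m := 0) (by exact_mod_cast hE)).continuousOn
  have hΔ : ContinuousOn (Δ[D] w) D :=
    (laplacianWithin_contDiffOn hD (m := 0) (by exact_mod_cast hw)).continuousOn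
  have hx : ∀ i, ContinuousOn (fun x : Euc n => x i) D := fun i =>
    (contDiff_coord (m := 0) i).continuous.continuousOn
  have hnorm : ContinuousOn (fun x : Euc n => ‖x‖ ^ 2) D := (continuous_norm.pow 2).continuousOn
  have hg : ∀ i, ContDiffOn ℝ 1 (fun x => w x * pd D i w x) D := fun i => hw1.mul (hp i)
  have hsum := sphInt_sum hρ0 hρ Finset.univ (g := fun i x =>
    ‖x‖ ^ 2 * pd D i (fun x => w x * pd D i w x) x
      - x i * eulerDeriv D (fun x => w x * pd D i w x) x
      - ((n : ℝ) - 1) * (x i * (w x * pd D i w x))) fun i _ =>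
    ((hnorm.mul (pd_contDiffOn hD (m := 0) (by exact_mod_cast hg i) i).continuousOn).sub
      ((hx i).mul (eulerDeriv_contDiffOn hD (m := 0) (by exact_mod_cast hg i)).continuousOn)).sub
      (continuousOn_const.mul ((hx i).mul (hg i).continuousOn))
  rw [Finset.sum_eq_zero fun i _ => sphInt_tangential hr hρ0 hρ (hg i) i] at hsum
  rw [← sub_eq_zero, ← sphInt_sub hρ0 hρ, ← hsum]
  · refine sphInt_congr hρ0 hρ fun x hx => ?_
    have d : ∀ {g : Euc n → ℝ}, ContDiffOn ℝ 1 g D → DifferentiableWithinAt ℝ g D x :=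
      fun h => h.differentiableOn one_ne_zero x hx
    -- Beyond the Hessian in the direction `x`, the iterated Euler derivative has a first-order
    -- term; it turns the `n - 1` of the tangential identity into the `n - 2` of the field.
    have hEE : eulerDeriv D (eulerDeriv D w) x
        = eulerDeriv D w x + ∑ i, x i * ∑ j, x j * pd D i (pd D j w) x := by
      rw [eulerDeriv_eq_sum D (eulerDeriv D w)]
      simp only [pd_eulerDeriv hD hw hx, mul_add, Finset.sum_add_distrib]
      rw [eulerDeriv_eq_sum]
    have hEx : ∑ i, x i * pd D i w x = eulerDeriv D w x := by rw [eulerDeriv_eq_sum]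
    have h1 : ∀ i, eulerDeriv D (fun y => w y * pd D i w y) x
        = w x * ∑ j, x j * pd D i (pd D j w) x + pd D i w x * eulerDeriv D w x := fun i => by
      rw [eulerDeriv_eq_sum D fun y => w y * pd D i w y, ← hEx]
      simp only [pd_mul hD hx (d hw1) (d (hp i)), Finset.mul_sum, ← Finset.sum_add_distrib]
      refine Finset.sum_congr rfl fun j _ => ?_
      rw [pd_comm hD hc hw hx]
      ring
    have h2 : ∑ i, x i * pohozaevField D w i x = ‖x‖ ^ 2 * (1 / 2 * ∑ j, pd D j w x * pd D j w x)
        - (((n : ℝ) - 2) / 2 * w x + eulerDeriv D w x) * eulerDeriv D w x := by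
      rw [norm_sq_eq_sum]
      simp only [pohozaevField, mul_sub, Finset.sum_sub_distrib, Finset.sum_mul]
      congr 1
      · exact Finset.sum_congr rfl fun i _ => by ring
      · refine Eq.trans ?_
          (congrArg ((((n : ℝ) - 2) / 2 * w x + eulerDeriv D w x) * ·) hEx)
        simp only [Finset.mul_sum]
        exact Finset.sum_congr rfl fun i _ => by ring
    have h3 : ∑ i, (‖x‖ ^ 2 * pd D i (fun x => w x * pd D i w x) x
        - x i * eulerDeriv D (fun x => w x * pd D i w x) x
        - ((n : ℝ) - 1) * (x i * (w x * pd D i w x)))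
        = ‖x‖ ^ 2 * (w x * ∑ i, pd D i (pd D i w) x + ∑ i, pd D i w x * pd D i w x)
          - (w x * ∑ i, x i * ∑ j, x j * pd D i (pd D j w) x + eulerDeriv D w x * eulerDeriv D w x)
          - ((n : ℝ) - 1) * (w x * eulerDeriv D w x) := by
      nth_rw 2 [← hEx]
      nth_rw 2 [← hEx]
      simp only [h1, pd_mul hD hx (d hw1) (d (hp _)), Finset.mul_sum,
        ← Finset.sum_add_distrib, ← Finset.sum_sub_distrib]
      refine Finset.sum_congr rfl fun i _ => ?_
      simp only [← Finset.mul_sum]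
      ring
    rw [h2, h3, hEE, laplacianWithin_eq_sum hD hw hx]
    ring
  · exact continuousOn_const.mul (continuousOn_finsetSum _ fun i _ =>
      (hx i).mul (pohozaevField_contDiffOn hD hw i).continuousOn)
  · exact (hnorm.mul (hΔ.neg.mul hw.continuousOn)).add
      ((hw.continuousOn.mul hEE).sub (hE.continuousOn.mul hE.continuousOn))

end Pohozaev

/-! ### Variation of the boundary functional and the nonlinear term. -/

section Main

variable {n : ℕ} {r s : ℝ} {u w : Euc n → ℝ}

theorem flux_pohozaevField {ρ : ℝ} (hr : 0 < r) (hρ0 : 0 ≤ ρ) (hρ : ρ ≤ r)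
    (hw : ContDiffOn ℝ 2 w (closedBall 0 r)) :
    flux ρ (pohozaevField (closedBall 0 r) w)
      = ρ / 2 * sphereIntegral ρ (fun x => -(Δ[closedBall 0 r] w) x * w x)
        + 1 / 2 * sphereIntegral ρ (fun x =>
          w x * normalDeriv (closedBall 0 r) (eulerDeriv (closedBall 0 r) w) x
            - eulerDeriv (closedBall 0 r) w x * normalDeriv (closedBall 0 r) w x) := by
  rcases hρ0.eq_or_lt with rfl | hpos
  · rw [flux_zero, sphereIntegral_zero_of_eq_zero (g := fun x => _ - _)]
    · simp
    · simp [normalDeriv_zero]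
  have key := sphInt_pohozaevField hr hρ0 hρ hw
  set D := closedBall (0 : Euc n) r
  have hD : UniqueDiffOn ℝ D := uniqueDiffOn_closedBall hr
  have hE : ContDiffOn ℝ 1 (eulerDeriv D w) D := by
    exact_mod_cast eulerDeriv_contDiffOn hD (m := 1) (by exact_mod_cast hw)
  have hEE : ContinuousOn (eulerDeriv D (eulerDeriv D w)) D :=
    (eulerDeriv_contDiffOn hD (m := 0) (by exact_mod_cast hE)).continuousOn
  have hΔ : ContinuousOn (Δ[D] w) D :=
    (laplacianWithin_contDiffOn hD (m := 0) (by exact_mod_cast hw)).continuousOn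
  have e1 : sphInt ρ (fun x => 2 * ∑ i, x i * pohozaevField D w i x)
      = 2 * ρ * ∫ ω : sphere (0 : Euc n) 1,
        ∑ i, (ω : Euc n) i * pohozaevField D w i (ρ • (ω : Euc n))
        ∂((volume : Measure (Euc n)).toSphere) := by
    rw [sphInt, ← integral_const_mul]
    congr 1
    funext ω
    simp only [Finset.mul_sum]
    exact Finset.sum_congr rfl fun i _ => by simp; ring
  have e2 : sphInt ρ (fun x => ‖x‖ ^ 2 * (-(Δ[D] w) x * w x))
      = ρ ^ 2 * sphInt ρ (fun x => -(Δ[D] w) x * w x) := by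
    rw [sphInt, sphInt, ← integral_const_mul]
    congr 1
    funext ω
    simp [norm_smul]
  have e3 : sphInt ρ (fun x => w x * eulerDeriv D (eulerDeriv D w) x
        - eulerDeriv D w x * eulerDeriv D w x)
      = ρ * sphInt ρ (fun x => w x * normalDeriv D (eulerDeriv D w) x
        - eulerDeriv D w x * normalDeriv D w x) := by
    rw [sphInt, sphInt, ← integral_const_mul]
    congr 1
    funext ω
    rw [← normalDeriv_smul_eq hpos D (eulerDeriv D w) ω]
    nth_rw 2 [← normalDeriv_smul_eq hpos D w ω]
    ring
  have hadd := sphInt_add hρ0 hρ (g := fun x => ‖x‖ ^ 2 * (-(Δ[D] w) x * w x))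
    (h := fun x => w x * eulerDeriv D (eulerDeriv D w) x - eulerDeriv D w x * eulerDeriv D w x)
    ((continuous_norm.pow 2).continuousOn.mul (hΔ.neg.mul hw.continuousOn))
    ((hw.continuousOn.mul hEE).sub (hE.continuousOn.mul hE.continuousOn))
  rw [hadd, e1, e2, e3] at key
  rw [sphereIntegral_eq, sphereIntegral_eq, flux]
  set I := ∫ ω : sphere (0 : Euc n) 1,
    ∑ i, (ω : Euc n) i * pohozaevField D w i (ρ • (ω : Euc n))
    ∂((volume : Measure (Euc n)).toSphere)
  have : 2 * I = ρ * sphInt ρ (fun x => -(Δ[D] w) x * w x)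
      + sphInt ρ (fun x => w x * normalDeriv D (eulerDeriv D w) x
        - eulerDeriv D w x * normalDeriv D w x) :=
    mul_left_cancel₀ hpos.ne' (by linear_combination key)
  linear_combination ρ ^ (n - 1) / 2 * this

theorem setIntegral_annulus_pohozaev (hn : 1 ≤ n) (hr : 0 < r) (hs : 0 ≤ s) (hsr : s ≤ r)
    (hw : ContDiffOn ℝ 2 w (closedBall 0 r)) :
    ∫ x in ball 0 r \ ball 0 s, (((n : ℝ) - 2) / 2 * w x + eulerDeriv (closedBall 0 r) w x)
        * -(Δ[closedBall 0 r] w) x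
      = flux r (pohozaevField (closedBall 0 r) w) - flux s (pohozaevField (closedBall 0 r) w) := by
  have hD := uniqueDiffOn_closedBall (n := n) hr
  rw [← setIntegral_annulus_div hn hr hs hsr fun i => pohozaevField_contDiffOn hD hw i]
  exact setIntegral_annulus_congr fun x hx =>
    (sum_pd_pohozaevField hD (closedBall_subset_closure_interior hr) hw hx).symm

theorem setIntegral_annulus_sq (hn : 1 ≤ n) (hr : 0 < r) (hs : 0 ≤ s) (hsr : s ≤ r)
    (hw : ContDiffOn ℝ 1 w (closedBall 0 r)) :
    ∫ x in ball 0 r \ ball 0 s, ((n : ℝ) / 2 * w x + eulerDeriv (closedBall 0 r) w x) * w x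
      = r / 2 * sphereIntegral r (fun x => w x ^ 2)
        - s / 2 * sphereIntegral s (fun x => w x ^ 2) := by
  have hD := uniqueDiffOn_closedBall (n := n) hr
  have h := setIntegral_annulus_radial hn hr hs hsr (g := fun x => w x ^ 2) (hw.pow 2)
  have h1 : ∫ x in ball 0 r \ ball 0 s, ((n : ℝ) / 2 * w x + eulerDeriv (closedBall 0 r) w x) * w x
      = ∫ x in ball 0 r \ ball 0 s,
        1 / 2 * (n * w x ^ 2 + eulerDeriv (closedBall 0 r) (fun x => w x ^ 2) x) := by
    refine setIntegral_annulus_congr fun x hx => ?_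
    have hd := hw.differentiableOn one_ne_zero x hx
    have : eulerDeriv (closedBall 0 r) (fun x => w x ^ 2) x
        = 2 * w x * eulerDeriv (closedBall 0 r) w x := by
      simp only [eulerDeriv_eq_sum, Finset.mul_sum, sq, pd_mul hD hx hd hd]
      exact Finset.sum_congr rfl fun i _ => by ring
    simp only [this]
    ring
  rw [h1, integral_const_mul, h]
  ring

/-- This is the middle integral left once `k / 2` Laplacians have been moved. -/
theorem bdryR_sub (hn : 1 ≤ n) (hr : 0 < r) (hs : 0 ≤ s) (hsr : s ≤ r) {k : ℕ} (hk : 1 ≤ k)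
    (hu : ContDiffOn ℝ (2 * k : ℕ) u (closedBall 0 r)) :
    bdryR (closedBall 0 r) k r u - bdryR (closedBall 0 r) k s u
      = ∫ x in ball 0 r \ ball 0 s,
        (((n : ℝ) - 2 * k) / 2 * polyLap (closedBall 0 r) (k / 2) u x
          + polyLap (closedBall 0 r) (k / 2) (eulerDeriv (closedBall 0 r) u) x)
          * polyLap (closedBall 0 r) (k - k / 2) u x := by
  have hD := uniqueDiffOn_closedBall (n := n) hr
  have hc := closedBall_subset_closure_interior (n := n) hr
  rw [setIntegral_annulus_congr fun x hx => congrArg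
    (fun y => (((n : ℝ) - 2 * k) / 2 * polyLap (closedBall 0 r) (k / 2) u x + y)
      * polyLap (closedBall 0 r) (k - k / 2) u x)
    (polyLap_eulerDeriv hD hc (k / 2) (hu.of_le (by norm_cast; lia)) hx)]
  -- The total coefficient `(n - 2k)/2 + 2m` of `w` is `n/2` for `k = 2m` and `(n - 2)/2` for `k =
  -- 2m + 1`, as the two divergence identities require.
  rcases Nat.even_or_odd' k with ⟨m, rfl | rfl⟩
  · have hw : ContDiffOn ℝ 1 (polyLap (closedBall 0 r) m u) (closedBall 0 r) := by
      exact_mod_cast polyLap_contDiffOn hD m (m := 1) (hu.of_le (by norm_cast; lia))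
    simp only [bdryR, even_two_mul, if_true, Nat.mul_div_cancel_left m two_pos,
      show 2 * m - m = m by lia]
    rw [← setIntegral_annulus_sq hn hr hs hsr hw]
    congr 1
    funext x
    push_cast
    ring
  · have hw : ContDiffOn ℝ 2 (polyLap (closedBall 0 r) m u) (closedBall 0 r) := by
      exact_mod_cast polyLap_contDiffOn hD m (m := 2) (hu.of_le (by norm_cast; lia))
    have hodd : ¬ Even (2 * m + 1) := Nat.not_even_bit1 m
    simp only [bdryR, hodd, if_false, show (2 * m + 1) / 2 = m by lia,
      show (2 * m + 1 + 1) / 2 = m + 1 by lia, show 2 * m + 1 - 1 = 2 * m by lia,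
      Nat.mul_div_cancel_left m two_pos, show 2 * m + 1 - m = m + 1 by lia, polyLap_succ]
    rw [← flux_pohozaevField hr hr.le le_rfl hw, ← flux_pohozaevField hr hs hsr hw,
      ← setIntegral_annulus_pohozaev hn hr hs hsr hw]
    congr 1
    funext x
    push_cast
    ring

theorem bdryP_sub (hn : 1 ≤ n) (hr : 0 < r) (hs : 0 ≤ s) (hsr : s ≤ r) {k : ℕ} (hk : 1 ≤ k)
    (hu : ContDiffOn ℝ (2 * k : ℕ) u (closedBall 0 r)) :
    bdryP (closedBall 0 r) k r u - bdryP (closedBall 0 r) k s u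
      = ∫ x in ball 0 r \ ball 0 s,
        (((n : ℝ) - 2 * k) / 2 * u x + eulerDeriv (closedBall 0 r) u x)
          * polyLap (closedBall 0 r) k u x := by
  set D := closedBall (0 : Euc n) r
  have hD : UniqueDiffOn ℝ D := uniqueDiffOn_closedBall hr
  -- One derivative is lost, but `2 * (k / 2) ≤ 2 * k - 1` since `k ≥ 1`, so half of the Laplacians
  -- may still fall on `eulerDeriv D u`.
  have hE : ContDiffOn ℝ (2 * k - 1 : ℕ) (eulerDeriv D u) D :=
    eulerDeriv_contDiffOn hD (by rwa [show 2 * k - 1 + 1 = 2 * k by lia])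
  have hu' : ∀ i ≤ k, ContinuousOn (polyLap D i u) D := fun i hi =>
    (polyLap_contDiffOn hD i (m := 0) (hu.of_le (by norm_cast; lia))).continuousOn
  have hE' : ContinuousOn (polyLap D (k / 2) (eulerDeriv D u)) D :=
    (polyLap_contDiffOn hD (k / 2) (m := 0) (hE.of_le (by norm_cast; lia))).continuousOn
  have split : ∀ {a b c : Euc n → ℝ}, ContinuousOn a D → ContinuousOn b D → ContinuousOn c D →
      ∀ γ : ℝ, ∫ x in ball 0 r \ ball 0 s, (γ * a x + b x) * c x
        = γ * (∫ x in ball 0 r \ ball 0 s, a x * c x) + ∫ x in ball 0 r \ ball 0 s, b x * c x := by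
    intro a b c ha hb hc γ
    rw [← integral_const_mul, ← integral_add]
    · congr 1
      funext x
      ring
    · exact (integrableOn_annulus (s := s) (ha.mul hc)).const_mul γ
    · exact integrableOn_annulus (hb.mul hc)
  have hR := bdryR_sub hn hr hs hsr hk hu
  rw [split (hu' _ (by lia)) hE' (hu' _ (by lia))] at hR
  have g1 := setIntegral_annulus_mul_polyLap hn hr hs hsr (m := k / 2) (by lia)
    (hu.of_le (by norm_cast; lia)) hu
  have g2 := setIntegral_annulus_mul_polyLap hn hr hs hsr (m := k / 2) (by lia)
    (hE.of_le (by norm_cast; lia)) hu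
  rw [split (hu.continuousOn) hE.continuousOn (hu' k le_rfl), g1, g2]
  simp only [bdryP, Finset.sum_add_distrib, ← Finset.mul_sum, Finset.sum_sub_distrib]
  linear_combination hR

theorem setIntegral_sub_sub_add {A : Set (Euc n)} {a b c d : Euc n → ℝ} (ha : IntegrableOn a A)
    (hb : IntegrableOn b A) (hc : IntegrableOn c A) (hd : IntegrableOn d A) (α β γ : ℝ) :
    ∫ x in A, (a x - α * b x - β * c x + γ * d x)
      = (∫ x in A, a x) - α * (∫ x in A, b x) - β * (∫ x in A, c x) + γ * ∫ x in A, d x := by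
  have h1 : IntegrableOn (fun x => a x - α * b x) A := ha.sub (hb.const_mul α)
  have h2 : IntegrableOn (fun x => a x - α * b x - β * c x) A := h1.sub (hc.const_mul β)
  rw [integral_add h2 (hd.const_mul γ), integral_sub h1 (hc.const_mul β),
    integral_sub ha (hb.const_mul α), integral_const_mul, integral_const_mul, integral_const_mul]

theorem eulerDeriv_mul_abs_rpow {D : Set (Euc n)} (hD : UniqueDiffOn ℝ D) {p : ℝ} (hp : 1 < p)
    {f : Euc n → ℝ} {x : Euc n} (hx : x ∈ D) (hf : DifferentiableWithinAt ℝ f D x)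
    (hu : DifferentiableWithinAt ℝ u D x) :
    eulerDeriv D (fun x => f x * |u x| ^ p) x
      = eulerDeriv D f x * |u x| ^ p
        + p * (f x * |u x| ^ (p - 2) * u x * eulerDeriv D u x) := by
  have h1 := (hasDerivAt_abs_rpow (u x) hp).comp_hasFDerivWithinAt x hu.hasFDerivWithinAt
  have h2 := (hf.hasFDerivWithinAt.mul h1).fderivWithin (hD x hx)
  have h3 : (fun x => f x * |u x| ^ p) = f * ((fun x => |x| ^ p) ∘ u) := rfl
  rw [eulerDeriv, h3, h2]
  simp [eulerDeriv]
  ring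

theorem abs_rpow_sub_two_mul_mul_self {p : ℝ} (hp : 2 ≤ p) (t : ℝ) :
    |t| ^ (p - 2) * t * t = |t| ^ p := by
  rcases eq_or_ne t 0 with rfl | ht
  · simp [Real.zero_rpow (by linarith : p ≠ 0)]
  · rw [mul_assoc, ← abs_mul_abs_self t, ← sq, ← Real.rpow_two, ← Real.rpow_add (abs_pos.2 ht)]
    ring_nf

end Main

end PolyPohozaev

open PolyPohozaev

theorem propositionA1 (n k : ℕ) (hn : 1 ≤ n) (hk : 1 ≤ k) (s r p : ℝ) (hs : 0 ≤ s) (hsr : s < r)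
    (hp : 2 ≤ p) (u f : PolyPohozaev.Euc n → ℝ)
    (hu : ContDiffOn ℝ ((2 * k : ℕ) : WithTop ℕ∞) u (closedBall 0 r))
    (hf : ContDiffOn ℝ 1 f (closedBall 0 r)) :
    PolyPohozaev.bdryP (closedBall 0 r) k r u - PolyPohozaev.bdryP (closedBall 0 r) k s u
      = (∫ x in ball 0 r \ ball 0 s,
          (((n : ℝ) - 2 * k) / 2 * u x + PolyPohozaev.eulerDeriv (closedBall 0 r) u x)
            * PolyPohozaev.equationError (closedBall 0 r) k p f u x)
        + (((n : ℝ) - 2 * k) / 2 - n / p) * (∫ x in ball 0 r \ ball 0 s, f x * |u x| ^ p)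
        - 1 / p * (∫ x in ball 0 r \ ball 0 s,
            PolyPohozaev.eulerDeriv (closedBall 0 r) f x * |u x| ^ p)
        + r / p * PolyPohozaev.sphereIntegral r (fun x => f x * |u x| ^ p)
        - s / p * PolyPohozaev.sphereIntegral s (fun x => f x * |u x| ^ p) := by
  have hr : 0 < r := hs.trans_lt hsr
  have hp0 : p ≠ 0 := by linarith
  have hD := uniqueDiffOn_closedBall (n := n) hr
  have hu1 : ContDiffOn ℝ 1 u (closedBall 0 r) := hu.of_le (by norm_cast; lia)
  have hE : ContinuousOn (eulerDeriv (closedBall 0 r) u) (closedBall 0 r) :=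
    (eulerDeriv_contDiffOn hD (m := 0) (by exact_mod_cast hu1)).continuousOn
  have hEf : ContinuousOn (eulerDeriv (closedBall 0 r) f) (closedBall 0 r) :=
    (eulerDeriv_contDiffOn hD (m := 0) (by exact_mod_cast hf)).continuousOn
  have hk' : ContinuousOn (polyLap (closedBall 0 r) k u) (closedBall 0 r) :=
    (polyLap_contDiffOn hD k (m := 0) (by simpa using hu)).continuousOn
  have habs : ContDiffOn ℝ 1 (fun x => |u x| ^ p) (closedBall 0 r) :=
    (contDiff_norm_rpow (E := ℝ) (by linarith : 1 < p)).comp_contDiffOn hu1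
  have hg : ContDiffOn ℝ 1 (fun x => f x * |u x| ^ p) (closedBall 0 r) := hf.mul habs
  have hEg : ContinuousOn (eulerDeriv (closedBall 0 r) fun x => f x * |u x| ^ p)
      (closedBall 0 r) :=
    (eulerDeriv_contDiffOn hD (m := 0) (by exact_mod_cast hg)).continuousOn
  have hrad := setIntegral_annulus_radial hn hr hs hsr.le hg
  have i1 : IntegrableOn (fun x => (((n : ℝ) - 2 * k) / 2 * u x
      + eulerDeriv (closedBall 0 r) u x) * polyLap (closedBall 0 r) k u x)
      (ball 0 r \ ball 0 s) :=
    integrableOn_annulus (((continuousOn_const.mul hu.continuousOn).add hE).mul hk')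
  have i2 : IntegrableOn (fun x => f x * |u x| ^ p) (ball 0 r \ ball 0 s) :=
    integrableOn_annulus hg.continuousOn
  have i3 : IntegrableOn (fun x => eulerDeriv (closedBall 0 r) f x * |u x| ^ p)
      (ball 0 r \ ball 0 s) := integrableOn_annulus (hEf.mul habs.continuousOn)
  have i4 : IntegrableOn (fun x => eulerDeriv (closedBall 0 r) (fun x => f x * |u x| ^ p) x)
      (ball 0 r \ ball 0 s) := integrableOn_annulus hEg
  -- The product `f |u|^(p-2) u E u` is replaced by `(E (f |u|^p) - (E f) |u|^p) / p`; the first of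
  -- these is then integrated by `hrad`.
  have hpt : EqOn (fun x => (((n : ℝ) - 2 * k) / 2 * u x + eulerDeriv (closedBall 0 r) u x)
        * equationError (closedBall 0 r) k p f u x)
      (fun x => (((((n : ℝ) - 2 * k) / 2 * u x + eulerDeriv (closedBall 0 r) u x)
          * polyLap (closedBall 0 r) k u x - ((n : ℝ) - 2 * k) / 2 * (f x * |u x| ^ p))
        - 1 / p * eulerDeriv (closedBall 0 r) (fun x => f x * |u x| ^ p) x)
        + 1 / p * (eulerDeriv (closedBall 0 r) f x * |u x| ^ p)) (closedBall 0 r) := by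
    intro x hx
    simp only [equationError]
    rw [eulerDeriv_mul_abs_rpow hD (by linarith) hx (hf.differentiableOn one_ne_zero x hx)
      (hu1.differentiableOn one_ne_zero x hx)]
    have := abs_rpow_sub_two_mul_mul_self hp (u x)
    field_simp
    linear_combination (-(p * f x * ((n : ℝ) - 2 * k))) * this
  have hsplit : ∫ x in ball 0 r \ ball 0 s, (n * (f x * |u x| ^ p)
      + eulerDeriv (closedBall 0 r) (fun x => f x * |u x| ^ p) x) = _ :=
    integral_add (i2.const_mul _) i4
  rw [integral_const_mul, hrad] at hsplit
  rw [bdryP_sub hn hr hs hsr.le hk hu, setIntegral_annulus_congr hpt,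
    setIntegral_sub_sub_add i1 i2 i4 i3]
  field_simp
  linear_combination (-2 : ℝ) * hsplit
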